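/- **Setting.** Let $(\mathcal S,\mathcal A,\gamma,P,r)$ be a finite discounted MDP with discount factor $\gamma\in[0,1)$ and reward $r:\mathcal S\times\mathcal A\to\mathbb R$, let $\pi$ be a target policy, $\mu$ a behaviour policy, $\lambda\in[0,1]$, $\phi:\mathcal S\times\mathcal A\to\mathbb R^d$ ($d\ge 1$) a feature map with feature matrix $\Phi$, $\xi$ a stationary distribution on $\mathcal S\times\mathcal A$ of the Markov chain induced by $\mu$, and $\Xi=\mathrm{diag}(\xi)$. Let $\kappa(s,a)=\pi(a|s)$ (Tree Backup) or $\kappa(s,a)=\min(1,\pi(a|s)/\mu(a|s))$ (Retrace). Put $P^\pi((s,a),(s',a'))=P(s'|s,a)\pi(a'|s')$, $P^{\kappa\mu}((s,a),(s',a'))=P(s'|s,a)\mu(a'|s')\kappa(s',a')$ and $$A=\Phi^\top\Xi(I-\lambda\gamma P^{\kappa\mu})^{-1}(\gamma P^\pi-I)\Phi,\qquad b=\Phi^\top\Xi(I-\lambda\gamma P^{\kappa\mu})^{-1}r,\qquad M=\Phi^\top\Xi\Phi .$$ **Algorithm.** At iteration $k$ one observes a stationary trajectory of $\mu$, namely the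 current pair $(s_k,a_k)$, its past, and the next state $s_{k+1}$; this sample is independent of the past $\mathcal F_{k-1}$ defined below (i.i.d. sampling model). Let $e_k=\sum_{j\ge0}(\lambda\gamma)^j\,\kappa(x_0)\cdots\kappa(x_{j-1})\,\phi(x_j)$ be its eligibility trace, where $x_j$ is the pair $j$ steps before the current one on that trajectory (so that along a trajectory $e=\lambda\gamma\kappa(s,a)\,e_{\mathrm{prev}}+\phi(s,a)$). Put $\mathbb E_\pi\phi(s,\cdot)=\sum_a\pi(a|s)\phi(s,a)$ and $$\hat A_k=e_k\big(\gamma\,\mathbb E_\pi\phi(s_{k+1},\cdot)-\phi(s_k,a_k)\big)^\top,\quad \hat b_k=r(s_k,a_k)e_k,\quad \hat M_k=\phi(s_k,a_k)\phi(s_k,a_k)^\top .$$ From random $(\theta_0,\omega_0)$ with $\mathbb E[\|\theta_0\|^2+\|\omega_0\|^2]<\infty$, iterate, with no projection and no averaging, $$\theta_{k+1}=\theta_k-\alpha_k\hat A_k^\top\omega_k,\qquad \omega_{k+1}=\omega_k+\beta\alpha_k\big(\hat A_k\theta_k+\hat b_k-\hat M_k\omega_k\big).$$ Let $z_k=(\theta_k,\omega_k/\sqrt\beta)$,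 $\hat G_k=\begin{pmatrix}0&\sqrt\beta\hat A_k^\top\\-\sqrt\beta\hat A_k&\beta\hat M_k\end{pmatrix}$, $\hat g_k=\begin{pmatrix}0\\\sqrt\beta\,\hat b_k\end{pmatrix}$, so that $z_{k+1}=z_k-\alpha_k(\hat G_kz_k-\hat g_k)$, and let $\mathcal F_{k-1}=\sigma(z_0,\hat G_0,\hat g_0,\dots,z_{k-1},\hat G_{k-1},\hat g_{k-1},z_k)$. **Assumptions.** $A$ and $M$ are nonsingular, $z^\star=(-A^{-1}b,0)$, and for a constant $\sigma$ and all $k$, almost surely, $\mathbb E[\|\hat G_kz_k-\hat g_k\|^2\mid\mathcal F_{k-1}]\le\sigma^2(1+\|z_k\|^2)$. **Constants.** With $\|\cdot\|$ the spectral norm, let $c(M)=\|M\|\|M^{-1}\|$, $\rho=\lambda_{\max}(A^\top M^{-1}A)$, $\delta=\lambda_{\min}(A^\top M^{-1}A)$, $L_G=\|\mathbb E[\hat G_k^\top\hat G_k\mid\mathcal F_{k-1}]\|$ (almost surely the same constant for all $k$), $\zeta=2\cdot 9^2c(M)^2\rho^2+32\,c(M)L_G$, $$\beta=\frac{8\rho}{\lambda_{\min}(M)},\qquad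 \alpha_k=\frac{9\cdot 8\cdot 2\,\delta}{8^2\delta^2(k+2)+9^2\zeta}.$$ **Claim.** For every $k\ge0$, $\mathbb E\|z_k-z^\star\|^2$ is finite and $$\mathbb E\|z_k-z^\star\|^2\le 9^2\cdot 8\,c(M)\left\{\frac{(8\delta+9\zeta)^2\,\mathbb E\|z_0-z^\star\|^2}{(8^2\delta^2k+9^2\zeta)^2}+\frac{8\sigma^2(1+\|z^\star\|^2)}{8^2\delta^2k+9^2\zeta}\right\};$$ in particular $\mathbb E\|z_k-z^\star\|^2=O(1/k)$. The same holds if $\hat M_k$ and $M$ are both replaced by the identity matrix. For $\lambda=0$ and features $\phi(s,a)=\phi(s)$ that depend on the state only, the algorithm is GTD2 (with $\hat M_k=\phi(s_k)\phi(s_k)^\top$) and GTD (with $\hat M_k=I$), so the bound applies to both. -/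

import Mathlib

noncomputable section

namespace OffPolicy

/-! ### The policy-evaluation problem -/

/-- The trace coefficients `κ` of the two return-based methods. -/
inductive TraceRule
  | treeBackup
  | retrace

/-- The quadratic form of the dual variable: the feature covariance (gradient Tree Backup, gradient
Retrace, GTD2) or the identity (GTD). -/
inductive DualForm
  | covariance
  | identity

/-- A finite discounted Markov decision process with a target policy, a behaviour policy, a
`d`-dimensional feature map, and a stationary distribution over state-action pairs of the Markov
chain induced by the behaviour policy. -/
structure Problem (S Act : Type*) [Fintype S] [Fintype Act] (d : ℕ) where
  /-- `trans s a s'` is the probability of moving to `s'` from `s` under action `a` -/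
  trans : S → Act → S → ℝ
  reward : S → Act → ℝ
  /-- the discount factor -/
  gam : ℝ
  /-- the trace parameter -/
  lam : ℝ
  target : S → Act → ℝ
  behavior : S → Act → ℝ
  feat : S → Act → Fin d → ℝ
  /-- the stationary distribution of the state-action pairs under `behavior` -/
  stat : S × Act → ℝ
  trans_nonneg : ∀ s a s', 0 ≤ trans s a s'
  trans_sum : ∀ s a, ∑ s', trans s a s' = 1
  gam_nonneg : 0 ≤ gam
  gam_lt_one : gam < 1
  lam_nonneg : 0 ≤ lam
  lam_le_one : lam ≤ 1
  target_nonneg : ∀ s a, 0 ≤ target s a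
  target_sum : ∀ s, ∑ a, target s a = 1
  behavior_nonneg : ∀ s a, 0 ≤ behavior s a
  behavior_sum : ∀ s, ∑ a, behavior s a = 1
  stat_nonneg : ∀ x, 0 ≤ stat x
  stat_sum : ∑ x, stat x = 1
  stat_invariant : ∀ y : S × Act,
    ∑ x : S × Act, stat x * (trans x.1 x.2 y.1 * behavior y.1 y.2) = stat y

namespace Problem

variable {S Act : Type*} [Fintype S] [Fintype Act] {d : ℕ}

/-- `κ(s, a)`: `π(a | s)` for Tree Backup, `min (1, π(a | s) / μ(a | s))` for Retrace. -/
def kappa (p : Problem S Act d) (rule : TraceRule) (x : S × Act) : ℝ :=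
  match rule with
  | TraceRule.treeBackup => p.target x.1 x.2
  | TraceRule.retrace => min 1 (p.target x.1 x.2 / p.behavior x.1 x.2)

/-- The matrix `P^π`. -/
def targetMatrix (p : Problem S Act d) : Matrix (S × Act) (S × Act) ℝ :=
  Matrix.of fun x y => p.trans x.1 x.2 y.1 * p.target y.1 y.2

/-- The matrix `P^{κμ}`. -/
def traceMatrix (p : Problem S Act d) (rule : TraceRule) : Matrix (S × Act) (S × Act) ℝ :=
  Matrix.of fun x y => p.trans x.1 x.2 y.1 * p.behavior y.1 y.2 * p.kappa rule y

/-- The feature matrix `Φ`, with rows indexed by the state-action pairs. -/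
def featMatrix (p : Problem S Act d) : Matrix (S × Act) (Fin d) ℝ :=
  Matrix.of fun x i => p.feat x.1 x.2 i

/-- `A = Φᵀ Ξ (I - λγ P^{κμ})⁻¹ (γ P^π - I) Φ`. -/
def matA [DecidableEq S] [DecidableEq Act] (p : Problem S Act d) (rule : TraceRule) :
    Matrix (Fin d) (Fin d) ℝ :=
  p.featMatrix.transpose * Matrix.diagonal p.stat *
    (1 - (p.lam * p.gam) • p.traceMatrix rule)⁻¹ * (p.gam • p.targetMatrix - 1) * p.featMatrix

/-- `b = Φᵀ Ξ (I - λγ P^{κμ})⁻¹ r`. -/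
def vecb [DecidableEq S] [DecidableEq Act] (p : Problem S Act d) (rule : TraceRule) :
    Fin d → ℝ :=
  (p.featMatrix.transpose * Matrix.diagonal p.stat *
    (1 - (p.lam * p.gam) • p.traceMatrix rule)⁻¹).mulVec fun x => p.reward x.1 x.2

/-- `M = Φᵀ Ξ Φ`, or the identity for the dual form of GTD. -/
def matM [DecidableEq S] [DecidableEq Act] (p : Problem S Act d) (form : DualForm) :
    Matrix (Fin d) (Fin d) ℝ :=
  match form with
  | DualForm.covariance => p.featMatrix.transpose * Matrix.diagonal p.stat * p.featMatrix
  | DualForm.identity => 1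

/-! ### One sample and the estimates made from it

A sample is a pair `(x, s')`: `x 0` is the current state-action pair, `x j` is the state-action pair
`j` steps earlier on the same trajectory, and `s'` is the state that follows `x 0`. -/

/-- The eligibility trace `e = ∑ j, (λγ)^j κ(x 0) ⋯ κ(x (j-1)) φ(x j)` of a trajectory. -/
def eligibility (p : Problem S Act d) (rule : TraceRule) (x : ℕ → S × Act) : Fin d → ℝ :=
  fun i => ∑' j : ℕ, (p.lam * p.gam) ^ j * (∏ l ∈ Finset.range j, p.kappa rule (x l)) *
    p.feat (x j).1 (x j).2 i

theorem kappa_nonneg (p : Problem S Act d) (rule : TraceRule) (x : S × Act) :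
    0 ≤ p.kappa rule x := by
  cases rule with
  | treeBackup => exact p.target_nonneg _ _
  | retrace =>
    exact le_min zero_le_one (div_nonneg (p.target_nonneg _ _) (p.behavior_nonneg _ _))

theorem kappa_le_one (p : Problem S Act d) (rule : TraceRule) (x : S × Act) :
    p.kappa rule x ≤ 1 := by
  cases rule with
  | treeBackup =>
    exact (Finset.single_le_sum (f := fun a => p.target x.1 a)
      (fun a _ => p.target_nonneg x.1 a) (Finset.mem_univ x.2)).trans (p.target_sum x.1).le
  | retrace => exact min_le_left _ _

/-- The series of the eligibility trace converges. -/
theorem eligibility_summable (p : Problem S Act d) (rule : TraceRule) (x : ℕ → S × Act)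
    (i : Fin d) :
    Summable fun j : ℕ => (p.lam * p.gam) ^ j *
      (∏ l ∈ Finset.range j, p.kappa rule (x l)) * p.feat (x j).1 (x j).2 i := by
  have h0 : 0 ≤ p.lam * p.gam := mul_nonneg p.lam_nonneg p.gam_nonneg
  have h1 : p.lam * p.gam < 1 :=
    (mul_le_of_le_one_left p.gam_nonneg p.lam_le_one).trans_lt p.gam_lt_one
  refine Summable.of_norm_bounded
    (g := fun j => (p.lam * p.gam) ^ j * ∑ y : S × Act, |p.feat y.1 y.2 i|)
    ((summable_geometric_of_lt_one h0 h1).mul_right _) fun j => ?_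
  have hp0 : 0 ≤ ∏ l ∈ Finset.range j, p.kappa rule (x l) :=
    Finset.prod_nonneg fun l _ => p.kappa_nonneg rule _
  have hp1 : ∏ l ∈ Finset.range j, p.kappa rule (x l) ≤ 1 :=
    Finset.prod_le_one (fun l _ => p.kappa_nonneg rule _) fun l _ => p.kappa_le_one rule _
  have hf : |p.feat (x j).1 (x j).2 i| ≤ ∑ y : S × Act, |p.feat y.1 y.2 i| :=
    Finset.single_le_sum (f := fun y : S × Act => |p.feat y.1 y.2 i|)
      (fun y _ => abs_nonneg _) (Finset.mem_univ (x j))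
  rw [Real.norm_eq_abs, abs_mul, abs_mul, abs_of_nonneg (pow_nonneg h0 j), abs_of_nonneg hp0,
    mul_assoc]
  refine mul_le_mul_of_nonneg_left ?_ (pow_nonneg h0 j)
  calc _ ≤ 1 * |p.feat (x j).1 (x j).2 i| := by gcongr
    _ ≤ _ := by rw [one_mul]; exact hf

/-- The recursion `e_k = λγ κ(s_k, a_k) e_{k-1} + φ(s_k, a_k)` along a trajectory. -/
theorem eligibility_recursion (p : Problem S Act d) (rule : TraceRule) (x : ℕ → S × Act) :
    p.eligibility rule x =
      (p.lam * p.gam * p.kappa rule (x 0)) • p.eligibility rule (fun j => x (j + 1)) +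
        p.feat (x 0).1 (x 0).2 := by
  funext i
  simp only [eligibility, Pi.add_apply, Pi.smul_apply, smul_eq_mul]
  rw [(p.eligibility_summable rule x i).tsum_eq_zero_add, ← tsum_mul_left]
  simp only [Finset.prod_range_succ', pow_succ, Finset.range_zero, Finset.prod_empty, pow_zero,
    one_mul]
  rw [add_comm]
  congr 1
  refine tsum_congr fun j => ?_
  ring

/-- `E_π φ(s, ·)`. -/
def meanFeat (p : Problem S Act d) (s : S) : Fin d → ℝ :=
  fun i => ∑ a, p.target s a * p.feat s a i

/-- `γ E_π φ(s', ·) - φ(s, a)`. -/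
def featDiff (p : Problem S Act d) (y : S × Act) (s' : S) : Fin d → ℝ :=
  p.gam • p.meanFeat s' - p.feat y.1 y.2

/-- `Â = e (γ E_π φ(s', ·) - φ(s, a))ᵀ`. -/
def estA (p : Problem S Act d) (rule : TraceRule) (x : ℕ → S × Act) (s' : S) :
    Matrix (Fin d) (Fin d) ℝ :=
  Matrix.vecMulVec (p.eligibility rule x) (p.featDiff (x 0) s')

/-- `b̂ = r(s, a) e`. -/
def estb (p : Problem S Act d) (rule : TraceRule) (x : ℕ → S × Act) : Fin d → ℝ :=
  p.reward (x 0).1 (x 0).2 • p.eligibility rule x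

/-- `M̂ = φ(s, a) φ(s, a)ᵀ`, or the identity for the dual form of GTD. -/
def estM (p : Problem S Act d) (form : DualForm) (x : ℕ → S × Act) :
    Matrix (Fin d) (Fin d) ℝ :=
  match form with
  | DualForm.covariance =>
      Matrix.vecMulVec (p.feat (x 0).1 (x 0).2) (p.feat (x 0).1 (x 0).2)
  | DualForm.identity => 1

/-- `Ĝ`, with blocks `0`, `√β Âᵀ`, `-√β Â`, `β M̂`. -/
def estG (p : Problem S Act d) (rule : TraceRule) (form : DualForm) (β : ℝ)
    (x : ℕ → S × Act) (s' : S) : Matrix (Fin d ⊕ Fin d) (Fin d ⊕ Fin d) ℝ :=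
  Matrix.fromBlocks 0 (√β • (p.estA rule x s').transpose) (-(√β • p.estA rule x s'))
    (β • p.estM form x)

/-- `ĝ = (0, √β b̂)`. -/
def estg (p : Problem S Act d) (rule : TraceRule) (β : ℝ) (x : ℕ → S × Act) :
    Fin d ⊕ Fin d → ℝ :=
  Sum.elim 0 (√β • p.estb rule x)

/-! ### The algorithm -/

/-- The temporal-difference error `r + γ θᵀ E_π φ(s', ·) - θᵀ φ(s, a)`. -/
def tdError (p : Problem S Act d) (θ : Fin d → ℝ) (y : S × Act) (s' : S) : ℝ :=
  p.reward y.1 y.2 + p.gam * (θ ⬝ᵥ p.meanFeat s') - θ ⬝ᵥ p.feat y.1 y.2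

/-- The iterates `(θ_k, ω_k)` of the algorithm, with step sizes `α k` for `θ` and `η k = β * α k`
for `ω`, when iteration `k` uses the sample `(x k, s' k)`. -/
def iterates (p : Problem S Act d) (rule : TraceRule) (form : DualForm) (α : ℕ → ℝ) (β : ℝ)
    (x : ℕ → ℕ → S × Act) (s' : ℕ → S) (θ₀ ω₀ : Fin d → ℝ) :
    ℕ → (Fin d → ℝ) × (Fin d → ℝ)
  | 0 => (θ₀, ω₀)
  | k + 1 =>
    let θ := (iterates p rule form α β x s' θ₀ ω₀ k).1
    let ω := (iterates p rule form α β x s' θ₀ ω₀ k).2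
    let e := p.eligibility rule (x k)
    (θ - (α k * (ω ⬝ᵥ e)) • p.featDiff (x k 0) (s' k),
      ω + (β * α k) • (p.tdError θ (x k 0) (s' k) • e - (p.estM form (x k)).mulVec ω))

/-- `z = (θ, ω / √β)`, with the Euclidean norm. -/
def joint (β : ℝ) (θ ω : Fin d → ℝ) : EuclideanSpace ℝ (Fin d ⊕ Fin d) :=
  WithLp.toLp 2 (Sum.elim θ ((1 / √β) • ω))

/-- The joint iterate `z_k = (θ_k, ω_k / √β)`. -/
def jointIterate (p : Problem S Act d) (rule : TraceRule) (form : DualForm) (α : ℕ → ℝ) (β : ℝ)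
    (x : ℕ → ℕ → S × Act) (s' : ℕ → S) (θ₀ ω₀ : Fin d → ℝ) (k : ℕ) :
    EuclideanSpace ℝ (Fin d ⊕ Fin d) :=
  joint β (p.iterates rule form α β x s' θ₀ ω₀ k).1 (p.iterates rule form α β x s' θ₀ ω₀ k).2

/-- `z* = (-A⁻¹ b, 0)`. -/
def solution [DecidableEq S] [DecidableEq Act] (p : Problem S Act d) (rule : TraceRule) (β : ℝ) :
    EuclideanSpace ℝ (Fin d ⊕ Fin d) :=
  joint β (-((p.matA rule)⁻¹.mulVec (p.vecb rule))) 0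

/-! ### The law of a sample -/

/-- The random sample `(X, S')` is a stationary trajectory of the behaviour policy: `X j` is the
state-action pair `j` steps before the current one and `S'` is the next state. The law is given on
the finite-dimensional cylinders. -/
structure IsStationarySample {Ω : Type*} [MeasurableSpace Ω] (p : Problem S Act d)
    (P : MeasureTheory.Measure Ω) (X : ℕ → Ω → S × Act) (S' : Ω → S) : Prop where
  measurable_pair : ∀ j, @Measurable Ω (S × Act) _ ⊤ (X j)
  measurable_next : @Measurable Ω S _ ⊤ S'
  law : ∀ (n : ℕ) (x : ℕ → S × Act) (s' : S),
    P.real {ω | (∀ j ≤ n, X j ω = x j) ∧ S' ω = s'} =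
      p.stat (x n) *
        (∏ j ∈ Finset.range n,
          p.trans (x (j + 1)).1 (x (j + 1)).2 (x j).1 * p.behavior (x j).1 (x j).2) *
        p.trans (x 0).1 (x 0).2 s'

/-- The sigma-algebra generated by a sample. -/
@[reducible] def sampleSigma {Ω : Type*} (X : ℕ → Ω → S × Act) (S' : Ω → S) : MeasurableSpace Ω :=
  (⨆ j : ℕ, MeasurableSpace.comap (X j) ⊤) ⊔ MeasurableSpace.comap S' ⊤

end Problem

/-- The sigma-algebra of the past at the beginning of iteration `k`: it is generated by
`z_0, Ĝ_0, ĝ_0, …, z_{k-1}, Ĝ_{k-1}, ĝ_{k-1}, z_k`. -/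
@[reducible] def pastSigma {Ω : Type*} {d : ℕ} (z : ℕ → Ω → EuclideanSpace ℝ (Fin d ⊕ Fin d))
    (G : ℕ → Ω → Matrix (Fin d ⊕ Fin d) (Fin d ⊕ Fin d) ℝ)
    (g : ℕ → Ω → Fin d ⊕ Fin d → ℝ) (k : ℕ) : MeasurableSpace Ω :=
  (⨆ i ≤ k, MeasurableSpace.comap (z i) inferInstance) ⊔
    ⨆ i < k, (⨆ (a : Fin d ⊕ Fin d) (b : Fin d ⊕ Fin d),
        MeasurableSpace.comap (fun ω => G i ω a b) inferInstance) ⊔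
      MeasurableSpace.comap (g i) inferInstance

/-! ### Spectral quantities -/

/-- The spectral norm of a real matrix. -/
def specNorm {n : Type*} [Fintype n] [DecidableEq n] (B : Matrix n n ℝ) : ℝ :=
  ‖Matrix.toEuclideanCLM (𝕜 := ℝ) B‖

/-- The condition number `c(B) = ‖B‖ ‖B⁻¹‖`. -/
def condNumber {n : Type*} [Fintype n] [DecidableEq n] (B : Matrix n n ℝ) : ℝ :=
  specNorm B * specNorm B⁻¹

/-- The largest real eigenvalue; used for symmetric matrices only. -/
def lamMax {n : Type*} [Fintype n] [DecidableEq n] (B : Matrix n n ℝ) : ℝ :=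
  sSup (spectrum ℝ B)

/-- The smallest real eigenvalue; used for symmetric matrices only. -/
def lamMin {n : Type*} [Fintype n] [DecidableEq n] (B : Matrix n n ℝ) : ℝ :=
  sInf (spectrum ℝ B)

/-- `ρ = λ_max(Aᵀ M⁻¹ A)`. -/
def rho {d : ℕ} (A M : Matrix (Fin d) (Fin d) ℝ) : ℝ := lamMax (A.transpose * M⁻¹ * A)

/-- `δ = λ_min(Aᵀ M⁻¹ A)`. -/
def delta {d : ℕ} (A M : Matrix (Fin d) (Fin d) ℝ) : ℝ := lamMin (A.transpose * M⁻¹ * A)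

/-- `β = 8 ρ / λ_min(M)`. -/
def beta {d : ℕ} (A M : Matrix (Fin d) (Fin d) ℝ) : ℝ := 8 * rho A M / lamMin M

/-- `ζ = 2 · 9² c(M)² ρ² + 32 c(M) L_G`. -/
def zeta {d : ℕ} (A M : Matrix (Fin d) (Fin d) ℝ) (LG : ℝ) : ℝ :=
  2 * 9 ^ 2 * condNumber M ^ 2 * rho A M ^ 2 + 32 * condNumber M * LG

/-- `α_k = 2 δ' / (δ'² (k + 2) + ζ)` with `δ' = 8 δ / 9`, cleared of inner denominators. -/
def stepSize {d : ℕ} (A M : Matrix (Fin d) (Fin d) ℝ) (LG : ℝ) (k : ℕ) : ℝ :=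
  9 * 8 * 2 * delta A M / (8 ^ 2 * delta A M ^ 2 * ((k : ℝ) + 2) + 9 ^ 2 * zeta A M LG)

end OffPolicy

end

noncomputable section

namespace OffPolicy

open Matrix MeasureTheory ProbabilityTheory

/-! ### A quadratic form contracted by the coupled system. -/

section Lyapunov

variable {n : Type*} [Fintype n]

/-! In the mean, the joint iterate follows `z ← z - α (G z - g)` with `G = (0, Xᵀ; -X, Y)`, `X = √β
A`, `Y = β M`. The symmetric part of `G` is only semidefinite, so the Euclidean norm need not
contract. The choice of `β` gives `Y ≥ 8ρ`, and moreover `X Xᵀ ≤ ρ Y` and `Xᵀ Y⁻¹ X ≥ δ`. With `J =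
diag(-1, 1)` the matrix `J G` is symmetric; hence so are `H = J (G - 4ρ)` and `H G`, which means
that `G` is self-adjoint for the form `H`. Here `ρ ≤ H ≤ 8ρ c(M)` (`symmetrizer_bounds`) and `δ H ≤
H G` (`symmetrizer_drift`). The ratio of the two bounds of `H` is the factor `8 c(M)` of the claim.

The estimates are unbiased: the weights `κ` along a stationary path turn transition probabilities
into entries of `P^{κμ}`, so the geometric series of the eligibility trace integrates to the Neumann
series of `(I - λγ P^{κμ})⁻¹` (`integral_eligibility_mul`). Since the sample is independent of the
past, one step multiplies the expected `H`-form of the error `D = z - z*` by at most `1 - 2δα + 16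
c(M) L_G α²` and adds a multiple of `α² q`, where `q = E‖Ĝ z* - ĝ‖²` (`expected_form_step_le`). The
scalar inequality `recursion_bound` turns this into a rate `1/k`.

It remains to bound `q`, because the moment assumption speaks of `z_k` and not of `z*`. The rate
with the unspecified constant `q` already shows `E‖D‖² → 0`. As `q` is the same for every sample,
comparing `Ĝ z* - ĝ` with `Ĝ z_k - ĝ` and letting `k → ∞` yields `q ≤ σ² (1 + ‖z*‖²)`; this is the
last part of `stochastic_approximation_bound`. -/

theorem dotProduct_sq_le (x y : n → ℝ) : (x ⬝ᵥ y) ^ 2 ≤ (x ⬝ᵥ x) * (y ⬝ᵥ y) := by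
  simpa [dotProduct, pow_two] using Finset.sum_mul_sq_le_sq_mul_sq Finset.univ x y

theorem dotProduct_self_nonneg_real (x : n → ℝ) : 0 ≤ x ⬝ᵥ x :=
  Finset.sum_nonneg fun i _ => mul_self_nonneg (x i)

theorem mulVec_dotProduct_eq (B : Matrix n n ℝ) (x y : n → ℝ) :
    (B *ᵥ x) ⬝ᵥ y = x ⬝ᵥ (Bᵀ *ᵥ y) := by
  rw [dotProduct_comm, dotProduct_mulVec, ← mulVec_transpose, dotProduct_comm]

/-- A symmetric matrix whose quadratic form lies between `0` and `ρ` satisfies `K² ≤ ρ K`. -/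
theorem mulVec_sq_le_of_form_le {K : Matrix n n ℝ} {ρ : ℝ} (hρ : 0 < ρ) (hK : Kᵀ = K)
    (h0 : ∀ x, 0 ≤ x ⬝ᵥ (K *ᵥ x)) (h1 : ∀ x, x ⬝ᵥ (K *ᵥ x) ≤ ρ * (x ⬝ᵥ x)) (x : n → ℝ) :
    (K *ᵥ x) ⬝ᵥ (K *ᵥ x) ≤ ρ * (x ⬝ᵥ (K *ᵥ x)) := by
  have e1 := h1 (K *ᵥ x)
  -- The test vector `ρ x - K x` produces `ρ² K - 2ρ K² + K³ ≥ 0`, and `e1` bounds `K³` by `ρ K²`.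
  have e0 := h0 (ρ • x - K *ᵥ x)
  simp only [mulVec_sub, mulVec_smul, dotProduct_sub, sub_dotProduct, smul_dotProduct,
    dotProduct_smul, smul_eq_mul] at e0
  have s1 : x ⬝ᵥ (K *ᵥ (K *ᵥ x)) = (K *ᵥ x) ⬝ᵥ (K *ᵥ x) := by
    rw [mulVec_dotProduct_eq K x, hK]
  rw [s1] at e0
  have : 0 ≤ ρ * (ρ * (x ⬝ᵥ (K *ᵥ x)) - (K *ᵥ x) ⬝ᵥ (K *ᵥ x)) := by
    nlinarith
  have := nonneg_of_mul_nonneg_right this hρ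
  linarith

/-- The form of the coupled system bounds from below `δ` times the form of the symmetrizer
`(4ρ, -Xᵀ; -X, Y - 4ρ)`. -/
theorem symmetrizer_drift [DecidableEq n] {X Y : Matrix n n ℝ} {ρ δ : ℝ} (hρ : 0 < ρ)
    (hδ : 0 < δ) (hδρ : δ ≤ ρ) (hY : Yᵀ = Y)
    (hY8 : ∀ x, 8 * ρ * (x ⬝ᵥ x) ≤ x ⬝ᵥ (Y *ᵥ x))
    (hXY : ∀ x, (Xᵀ *ᵥ x) ⬝ᵥ (Xᵀ *ᵥ x) ≤ ρ * (x ⬝ᵥ (Y *ᵥ x)))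
    (hYX : ∀ u, δ * (u ⬝ᵥ u) ≤ (X *ᵥ u) ⬝ᵥ (Y⁻¹ *ᵥ (X *ᵥ u))) (u w : n → ℝ) :
    δ * (4 * ρ * (u ⬝ᵥ u) - 2 * ((X *ᵥ u) ⬝ᵥ w) + w ⬝ᵥ (Y *ᵥ w) - 4 * ρ * (w ⬝ᵥ w)) ≤
      ((4 * ρ) • u - Xᵀ *ᵥ w) ⬝ᵥ (Xᵀ *ᵥ w) +
        (Y *ᵥ w - X *ᵥ u - (4 * ρ) • w) ⬝ᵥ (Y *ᵥ w - X *ᵥ u) := by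
  have ns := dotProduct_self_nonneg_real (n := n)
  have hinj : ∀ {Z : Matrix n n ℝ} {c : ℝ}, 0 < c → (∀ x, c * (x ⬝ᵥ x) ≤ x ⬝ᵥ (Z *ᵥ x)) →
      IsUnit Z.det := by
    intro Z c hc h
    rw [isUnit_iff_ne_zero]
    intro hdet
    obtain ⟨v, hv, hv0⟩ := exists_mulVec_eq_zero_iff.2 hdet
    have := h v
    rw [hv0, dotProduct_zero] at this
    have h2 := ns v
    have : v ⬝ᵥ v = 0 := by nlinarith
    exact hv (dotProduct_self_eq_zero.1 this)
  set D : Matrix n n ℝ := Y - δ • 1 with hD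
  have hDx : ∀ x, D *ᵥ x = Y *ᵥ x - δ • x := fun x => by
    rw [hD, sub_mulVec, smul_mulVec, one_mulVec]
  have hD7 : ∀ x, 7 * ρ * (x ⬝ᵥ x) ≤ x ⬝ᵥ (D *ᵥ x) := fun x => by
    rw [hDx, dotProduct_sub, dotProduct_smul, smul_eq_mul]
    nlinarith [hY8 x, ns x]
  have hDt : Dᵀ = D := by rw [hD, transpose_sub, hY, transpose_smul, transpose_one]
  have hYu : IsUnit Y.det := hinj (by positivity) hY8
  have hDu : IsUnit D.det := hinj (by positivity) hD7
  have hDinv : ∀ x, D *ᵥ (D⁻¹ *ᵥ x) = x := fun x => by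
    rw [mulVec_mulVec, mul_nonsing_inv _ hDu, one_mulVec]
  have hYinv : ∀ x, Y *ᵥ (Y⁻¹ *ᵥ x) = x := fun x => by
    rw [mulVec_mulVec, mul_nonsing_inv _ hYu, one_mulVec]
  have hYinv' : ∀ x, Y⁻¹ *ᵥ (Y *ᵥ x) = x := fun x => by
    rw [mulVec_mulVec, nonsing_inv_mul _ hYu, one_mulVec]
  have hDit : (D⁻¹)ᵀ = D⁻¹ := by rw [transpose_nonsing_inv, hDt]
  -- `K` is the Schur complement of the block `D` in `G - δ = (-δ, Xᵀ; -X, D)`. The next two bounds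
  -- place it between `0` and `ρ`.
  set K : Matrix n n ℝ := Xᵀ * D⁻¹ * X - δ • 1 with hK
  have hKx : ∀ x, K *ᵥ x = Xᵀ *ᵥ (D⁻¹ *ᵥ (X *ᵥ x)) - δ • x := fun x => by
    rw [hK, sub_mulVec, smul_mulVec, one_mulVec, mulVec_mulVec, mulVec_mulVec, Matrix.mul_assoc]
  have hKt : Kᵀ = K := by
    rw [hK, transpose_sub, transpose_mul, transpose_mul, transpose_transpose, hDit, transpose_smul,
      transpose_one, Matrix.mul_assoc]
  have hform : ∀ x, x ⬝ᵥ (K *ᵥ x) = (X *ᵥ x) ⬝ᵥ (D⁻¹ *ᵥ (X *ᵥ x)) - δ * (x ⬝ᵥ x) := fun x => by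
    rw [hKx, dotProduct_sub, dotProduct_smul, smul_eq_mul, mulVec_dotProduct_eq X]
  -- The reason is `D⁻¹ ≥ Y⁻¹`, combined with `hYX`. The difference of the two forms at `q` is `δ (t
  -- ⬝ᵥ t - δ (t ⬝ᵥ m))`, nonnegative because `Y ≥ 8ρ ≥ δ`.
  have hK0 : ∀ x, 0 ≤ x ⬝ᵥ (K *ᵥ x) := by
    intro x
    rw [hform]
    have h1 := hYX x
    set q := X *ᵥ x
    set t := D⁻¹ *ᵥ q with ht
    have hq : q = Y *ᵥ t - δ • t := by rw [← hDx, ht, hDinv]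
    set m := Y⁻¹ *ᵥ t with hm
    have hq' : Y⁻¹ *ᵥ q = t - δ • m := by
      rw [hq, mulVec_sub, hYinv', mulVec_smul]
    have htm : t = Y *ᵥ m := by rw [hm, hYinv]
    have hqm : q ⬝ᵥ m = t ⬝ᵥ t - δ * (t ⬝ᵥ m) := by
      rw [hq, sub_dotProduct, smul_dotProduct, smul_eq_mul, mulVec_dotProduct_eq, hY, ← htm]
    have h8 : 8 * ρ * (m ⬝ᵥ m) ≤ t ⬝ᵥ m := by
      have := hY8 m
      rwa [← htm, dotProduct_comm m t] at this
    have hcs := dotProduct_sq_le t m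
    have hpos : 0 ≤ t ⬝ᵥ m := le_trans (by have := ns m; positivity) h8
    have h3 : 8 * ρ * (t ⬝ᵥ m) ≤ t ⬝ᵥ t := by
      rcases hpos.eq_or_lt with h | h
      · rw [← h]; simpa using ns t
      · have : (t ⬝ᵥ m) * (8 * ρ * (t ⬝ᵥ m)) ≤ (t ⬝ᵥ m) * (t ⬝ᵥ t) := by
          nlinarith [mul_le_mul_of_nonneg_left h8 (ns t)]
        exact le_of_mul_le_mul_left this h
    rw [hq', dotProduct_sub, dotProduct_smul, smul_eq_mul, hqm] at h1
    have : 0 ≤ δ * (t ⬝ᵥ t - δ * (t ⬝ᵥ m)) := by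
      refine mul_nonneg hδ.le ?_
      nlinarith
    linarith
  -- Cauchy–Schwarz for `q ⬝ᵥ t = x ⬝ᵥ Xᵀ t`, with `X Xᵀ ≤ ρ Y = ρ (D + δ)`, gives `Xᵀ D⁻¹ X ≤ ρ +
  -- δ`.
  have hK1 : ∀ x, x ⬝ᵥ (K *ᵥ x) ≤ ρ * (x ⬝ᵥ x) := by
    intro x
    rw [hform]
    set q := X *ᵥ x with hqd
    set t := D⁻¹ *ᵥ q with ht
    have hq : q = D *ᵥ t := by rw [ht, hDinv]
    have h7 : 7 * ρ * (t ⬝ᵥ t) ≤ q ⬝ᵥ t := by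
      have := hD7 t
      rwa [← hq, dotProduct_comm t q] at this
    have hYt : t ⬝ᵥ (Y *ᵥ t) = q ⬝ᵥ t + δ * (t ⬝ᵥ t) := by
      rw [hq, hDx, sub_dotProduct, smul_dotProduct, smul_eq_mul, dotProduct_comm t]; ring
    have hx := hXY t
    rw [hYt] at hx
    have hcs := dotProduct_sq_le x (Xᵀ *ᵥ t)
    rw [← mulVec_dotProduct_eq, ← hqd] at hcs
    have hpos : 0 ≤ q ⬝ᵥ t := le_trans (by have := ns t; positivity) h7
    have hb : ρ * (q ⬝ᵥ t + δ * (t ⬝ᵥ t)) ≤ (ρ + δ) * (q ⬝ᵥ t) := by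
      nlinarith [ns t]
    have hc : (q ⬝ᵥ t) ^ 2 ≤ (x ⬝ᵥ x) * ((ρ + δ) * (q ⬝ᵥ t)) :=
      hcs.trans (mul_le_mul_of_nonneg_left (hx.trans hb) (ns x))
    have : q ⬝ᵥ t ≤ (ρ + δ) * (x ⬝ᵥ x) := by
      rcases hpos.eq_or_lt with h | h
      · rw [← h]; have := ns x; positivity
      · have : (q ⬝ᵥ t) * (q ⬝ᵥ t) ≤ (q ⬝ᵥ t) * ((ρ + δ) * (x ⬝ᵥ x)) := by nlinarith
        exact le_of_mul_le_mul_left this h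
    linarith
  have hKK := mulVec_sq_le_of_form_le hρ hKt hK0 hK1 u
  -- the residual of the fast component
  set t := D⁻¹ *ᵥ (X *ᵥ u) with ht
  -- In these coordinates `(G - δ)(u, w) = (K u + Xᵀ s, D s)`: block elimination decouples the
  -- second component.
  obtain ⟨s, rfl⟩ : ∃ s, w = t + s := ⟨w - t, by simp⟩
  have hXu : X *ᵥ u = D *ᵥ t := by rw [ht, hDinv]
  have hYD : ∀ x, Y *ᵥ x = D *ᵥ x + δ • x := fun x => by rw [hDx]; simp
  have hXt : Xᵀ *ᵥ t = K *ᵥ u + δ • u := by rw [hKx]; simp [ht]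
  have huK : u ⬝ᵥ (K *ᵥ u) = (D *ᵥ t) ⬝ᵥ t - δ * (u ⬝ᵥ u) := by rw [hform, ← ht, hXu]
  have hus : u ⬝ᵥ (Xᵀ *ᵥ s) = (D *ᵥ t) ⬝ᵥ s := by rw [← mulVec_dotProduct_eq, hXu]
  -- Write `x = (u, w)` and `y = (G - δ) x`. Since `H x = (G - 4ρ)ᵀ J x`, the form of `H (G - δ)` at
  -- `x` is `y ⬝ᵥ J y - (4ρ - δ) (x ⬝ᵥ J y)`; in the last product the mixed terms `t ⬝ᵥ D s` cancel.
  have key : ((4 * ρ) • u - Xᵀ *ᵥ (t + s)) ⬝ᵥ (Xᵀ *ᵥ (t + s)) +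
        (Y *ᵥ (t + s) - X *ᵥ u - (4 * ρ) • (t + s)) ⬝ᵥ (Y *ᵥ (t + s) - X *ᵥ u) -
      δ * (4 * ρ * (u ⬝ᵥ u) - 2 * ((X *ᵥ u) ⬝ᵥ (t + s)) + (t + s) ⬝ᵥ (Y *ᵥ (t + s)) -
        4 * ρ * ((t + s) ⬝ᵥ (t + s))) =
      (4 * ρ - δ) * (u ⬝ᵥ (K *ᵥ u) - s ⬝ᵥ (D *ᵥ s)) -
        (K *ᵥ u + Xᵀ *ᵥ s) ⬝ᵥ (K *ᵥ u + Xᵀ *ᵥ s) + (D *ᵥ s) ⬝ᵥ (D *ᵥ s) := by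
    have e1 : u ⬝ᵥ (K *ᵥ u) = (K *ᵥ u) ⬝ᵥ u := dotProduct_comm _ _
    have e2 : t ⬝ᵥ (D *ᵥ s) = (D *ᵥ t) ⬝ᵥ s := by
      rw [mulVec_dotProduct_eq D t s, hDt]
    have e3 : s ⬝ᵥ (D *ᵥ t) = (D *ᵥ t) ⬝ᵥ s := dotProduct_comm _ _
    have e4 : t ⬝ᵥ (D *ᵥ t) = (D *ᵥ t) ⬝ᵥ t := dotProduct_comm _ _
    have e5 : s ⬝ᵥ (D *ᵥ s) = (D *ᵥ s) ⬝ᵥ s := dotProduct_comm _ _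
    have e6 : s ⬝ᵥ t = t ⬝ᵥ s := dotProduct_comm _ _
    have e7 : (Xᵀ *ᵥ s) ⬝ᵥ (K *ᵥ u) = (K *ᵥ u) ⬝ᵥ (Xᵀ *ᵥ s) := dotProduct_comm _ _
    have e8 : (Xᵀ *ᵥ s) ⬝ᵥ u = u ⬝ᵥ (Xᵀ *ᵥ s) := dotProduct_comm _ _
    have e9 : (D *ᵥ s) ⬝ᵥ t = (D *ᵥ t) ⬝ᵥ s := by rw [dotProduct_comm, e2]
    simp only [mulVec_add, hXt, hYD, hXu, dotProduct_add, add_dotProduct, dotProduct_sub,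
      sub_dotProduct, smul_dotProduct, dotProduct_smul, smul_eq_mul, smul_add]
    rw [e2, e3, e4, e5, e6, e7, e8, e9, hus]
    rw [huK] at *
    rw [← e1]
    ring
  have hs1 := hXY s
  have hs2 := hD7 s
  have hs3 : s ⬝ᵥ (Y *ᵥ s) = s ⬝ᵥ (D *ᵥ s) + δ * (s ⬝ᵥ s) := by
    rw [hYD, dotProduct_add, dotProduct_smul, smul_eq_mul]
  have hpos : 0 ≤ s ⬝ᵥ (D *ᵥ s) := le_trans (by have := ns s; positivity) hs2
  have hs4 : 7 * ρ * (s ⬝ᵥ (D *ᵥ s)) ≤ (D *ᵥ s) ⬝ᵥ (D *ᵥ s) := by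
    have hcs := dotProduct_sq_le s (D *ᵥ s)
    rcases hpos.eq_or_lt with h | h
    · rw [← h]; simpa using ns _
    · have : (s ⬝ᵥ (D *ᵥ s)) * (7 * ρ * (s ⬝ᵥ (D *ᵥ s))) ≤
          (s ⬝ᵥ (D *ᵥ s)) * ((D *ᵥ s) ⬝ᵥ (D *ᵥ s)) := by
        nlinarith [mul_le_mul_of_nonneg_right hs2 (ns (D *ᵥ s))]
      exact le_of_mul_le_mul_left this h
  -- Young's inequality weighted so that `‖K u‖²` has coefficient `3`: with `K² ≤ ρ K` it is then
  -- absorbed by `(4ρ - δ) K ≥ 3ρ K`.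
  have hy : (K *ᵥ u + Xᵀ *ᵥ s) ⬝ᵥ (K *ᵥ u + Xᵀ *ᵥ s) ≤
      3 * ((K *ᵥ u) ⬝ᵥ (K *ᵥ u)) + 3 / 2 * ((Xᵀ *ᵥ s) ⬝ᵥ (Xᵀ *ᵥ s)) := by
    have := ns ((2 : ℝ) • (K *ᵥ u) - Xᵀ *ᵥ s)
    simp only [dotProduct_add, add_dotProduct, dotProduct_sub, sub_dotProduct, smul_dotProduct,
      dotProduct_smul, smul_eq_mul] at this ⊢
    rw [dotProduct_comm (Xᵀ *ᵥ s) (K *ᵥ u)] at *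
    linarith
  have hu : 3 * ρ * (u ⬝ᵥ (K *ᵥ u)) ≤ (4 * ρ - δ) * (u ⬝ᵥ (K *ᵥ u)) :=
    mul_le_mul_of_nonneg_right (by linarith) (hK0 u)
  have hδs : ρ * (δ * (s ⬝ᵥ s)) ≤ ρ * (s ⬝ᵥ (D *ᵥ s)) / 7 := by
    have := mul_le_mul_of_nonneg_right hδρ (ns s)
    nlinarith
  -- In units of `ρ (s ⬝ᵥ D s)`, the gain is `7` from `‖D s‖²`; the losses are at most `4` and
  -- `(3/2)(8/7) = 12/7`.
  nlinarith [mul_nonneg hρ.le hpos, mul_nonneg hδ.le hpos]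

/-- Two-sided bounds of the symmetrizer by the Euclidean norm. -/
theorem symmetrizer_bounds {X Y : Matrix n n ℝ} {ρ c : ℝ} (hρ : 0 < ρ) (hc : 1 ≤ c)
    (hY8 : ∀ x, 8 * ρ * (x ⬝ᵥ x) ≤ x ⬝ᵥ (Y *ᵥ x))
    (hYc : ∀ x, x ⬝ᵥ (Y *ᵥ x) ≤ 8 * ρ * c * (x ⬝ᵥ x))
    (hXY : ∀ x, (Xᵀ *ᵥ x) ⬝ᵥ (Xᵀ *ᵥ x) ≤ ρ * (x ⬝ᵥ (Y *ᵥ x))) (u w : n → ℝ) :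
    ρ * (u ⬝ᵥ u + w ⬝ᵥ w) ≤
        4 * ρ * (u ⬝ᵥ u) - 2 * ((X *ᵥ u) ⬝ᵥ w) + w ⬝ᵥ (Y *ᵥ w) - 4 * ρ * (w ⬝ᵥ w) ∧
      4 * ρ * (u ⬝ᵥ u) - 2 * ((X *ᵥ u) ⬝ᵥ w) + w ⬝ᵥ (Y *ᵥ w) - 4 * ρ * (w ⬝ᵥ w) ≤
        8 * ρ * c * (u ⬝ᵥ u + w ⬝ᵥ w) := by
  have ns := dotProduct_self_nonneg_real (n := n)
  have hx := hXY w
  have h8 := hY8 w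
  have h9 := hYc w
  have hw := ns w
  have hu := ns u
  have e : (X *ᵥ u) ⬝ᵥ w = u ⬝ᵥ (Xᵀ *ᵥ w) := mulVec_dotProduct_eq _ _ _
  rw [e]
  -- These squares control the cross term. The weight `3ρ` leaves `ρ` on `u` and `(2/3)·8ρ - 4ρ ≥ ρ`
  -- on `w`; with the weight `2cρ` the `w` part of the cross term is at most `4ρ (w ⬝ᵥ w)`, which
  -- the block `-4ρ` cancels.
  have a1 := ns ((3 * ρ) • u - Xᵀ *ᵥ w)
  have a2 := ns ((2 * c * ρ) • u + Xᵀ *ᵥ w)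
  simp only [dotProduct_add, add_dotProduct, dotProduct_sub, sub_dotProduct, smul_dotProduct,
    dotProduct_smul, smul_eq_mul] at a1 a2
  rw [dotProduct_comm (Xᵀ *ᵥ w) u] at a1 a2
  generalize u ⬝ᵥ (Xᵀ *ᵥ w) = t at *
  generalize (Xᵀ *ᵥ w) ⬝ᵥ (Xᵀ *ᵥ w) = q at *
  generalize w ⬝ᵥ (Y *ᵥ w) = y at *
  generalize w ⬝ᵥ w = b at *
  generalize u ⬝ᵥ u = a at *
  have hb : 0 ≤ ρ * b := by positivity
  constructor
  · have : 0 ≤ 3 * ρ * (3 * ρ * a - 2 * t + y / 3) := by linarith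
    have := nonneg_of_mul_nonneg_right this (by positivity)
    linarith
  · have h1 : ρ * y ≤ ρ * (8 * ρ * c * b) := mul_le_mul_of_nonneg_left h9 hρ.le
    have : 0 ≤ 2 * c * ρ * (2 * c * ρ * a + 2 * t + 4 * ρ * b) := by linarith
    have := nonneg_of_mul_nonneg_right this (by positivity)
    have h2 : 0 ≤ (c - 1) * (ρ * a) := mul_nonneg (by linarith) (by positivity)
    linarith [mul_nonneg hρ.le hu]

end Lyapunov

/-! ### The scalar recursion. -/

/-- The decay of a stochastic-approximation recursion with step sizes `2δ / (δ²(k+2) + ζ)`. -/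
theorem recursion_bound {δ ζ η B : ℝ} {a : ℕ → ℝ} (hδ : 0 < δ) (hζ : 0 < ζ) (hB : 0 ≤ B)
    (hη : η + δ ^ 2 / 4 ≤ ζ / 2) (ha : ∀ k, 0 ≤ a k)
    (hrec : ∀ k : ℕ, a (k + 1) ≤
      (1 - 2 * δ * (2 * δ / (δ ^ 2 * (k + 2) + ζ)) + η * (2 * δ / (δ ^ 2 * (k + 2) + ζ)) ^ 2) * a k
        + (2 * δ / (δ ^ 2 * (k + 2) + ζ)) ^ 2 * B) (k : ℕ) :
    a k ≤ ζ ^ 2 * a 0 / (δ ^ 2 * k + ζ) ^ 2 + 4 * B / (δ ^ 2 * k + ζ) := by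
  induction k with
  | zero =>
    simp only [Nat.cast_zero, mul_zero, zero_add]
    rw [mul_div_cancel_left₀ _ (by positivity)]
    have : 0 ≤ 4 * B / ζ := by positivity
    linarith
  | succ k ih =>
    set t : ℝ := δ ^ 2 * k + ζ with ht
    have ht0 : 0 < t := by positivity
    have e1 : δ ^ 2 * ((k + 1 : ℕ) : ℝ) + ζ = t + δ ^ 2 := by push_cast; ring
    have e2 : δ ^ 2 * ((k : ℝ) + 2) + ζ = t + 2 * δ ^ 2 := by ring
    have hζt : ζ ≤ t := by rw [ht]; have : 0 ≤ δ ^ 2 * (k : ℝ) := by positivity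
                           linarith
    have h := hrec k
    rw [e2] at h
    rw [e1]
    -- This factor carries the initial-error term exactly from `1/t²` to `1/(t + δ²)²`. The
    -- hypothesis on `η` enters as `η ≤ t/2 - δ²/4`.
    have hf : 1 - 2 * δ * (2 * δ / (t + 2 * δ ^ 2)) + η * (2 * δ / (t + 2 * δ ^ 2)) ^ 2 ≤
        t ^ 2 / (t + δ ^ 2) ^ 2 := by
      rw [← sub_nonneg]
      have : t ^ 2 / (t + δ ^ 2) ^ 2 -
          (1 - 2 * δ * (2 * δ / (t + 2 * δ ^ 2)) + η * (2 * δ / (t + 2 * δ ^ 2)) ^ 2) =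
          (t ^ 2 * (t + 2 * δ ^ 2) ^ 2 - (t + δ ^ 2) ^ 2 * ((t + 2 * δ ^ 2) ^ 2
            - 4 * δ ^ 2 * (t + 2 * δ ^ 2) + 4 * δ ^ 2 * η)) /
            ((t + δ ^ 2) ^ 2 * (t + 2 * δ ^ 2) ^ 2) := by
        field_simp
        ring
      rw [this]
      refine div_nonneg ?_ (by positivity)
      have h1 : (t + δ ^ 2) ^ 2 * (4 * δ ^ 2 * η) ≤
          (t + δ ^ 2) ^ 2 * (4 * δ ^ 2 * (t / 2 - δ ^ 2 / 4)) := by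
        gcongr; linarith
      have h2 : 0 ≤ t ^ 2 * (t + 2 * δ ^ 2) ^ 2 - (t + δ ^ 2) ^ 2 * ((t + 2 * δ ^ 2) ^ 2
            - 4 * δ ^ 2 * (t + 2 * δ ^ 2) + 4 * δ ^ 2 * (t / 2 - δ ^ 2 / 4)) := by
        have : t ^ 2 * (t + 2 * δ ^ 2) ^ 2 - (t + δ ^ 2) ^ 2 * ((t + 2 * δ ^ 2) ^ 2
            - 4 * δ ^ 2 * (t + 2 * δ ^ 2) + 4 * δ ^ 2 * (t / 2 - δ ^ 2 / 4)) =
            5 * (δ ^ 2) ^ 4 + 8 * (δ ^ 2) ^ 3 * t + 4 * (δ ^ 2) ^ 2 * t ^ 2 := by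
          ring
        rw [this]
        positivity
      linarith
    -- For the noise term a weaker factor, with the same denominator as the step size, suffices.
    have hg : t ^ 2 / (t + δ ^ 2) ^ 2 ≤ t / (t + 2 * δ ^ 2) := by
      rw [div_le_div_iff₀ (by positivity) (by positivity)]
      nlinarith [sq_nonneg (δ ^ 2), mul_nonneg ht0.le (sq_nonneg (δ ^ 2))]
    calc a (k + 1) ≤ t ^ 2 / (t + δ ^ 2) ^ 2 * a k + (2 * δ / (t + 2 * δ ^ 2)) ^ 2 * B :=
          h.trans (by gcongr; exact ha k)
      _ ≤ t ^ 2 / (t + δ ^ 2) ^ 2 * (ζ ^ 2 * a 0 / t ^ 2 + 4 * B / t) +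
          (2 * δ / (t + 2 * δ ^ 2)) ^ 2 * B := by gcongr
      _ = ζ ^ 2 * a 0 / (t + δ ^ 2) ^ 2 + (t ^ 2 / (t + δ ^ 2) ^ 2 * (4 * B / t) +
          (2 * δ / (t + 2 * δ ^ 2)) ^ 2 * B) := by
        rw [mul_add, add_assoc]; congr 1; field_simp
      _ ≤ ζ ^ 2 * a 0 / (t + δ ^ 2) ^ 2 + (t / (t + 2 * δ ^ 2) * (4 * B / t) +
          (2 * δ / (t + 2 * δ ^ 2)) ^ 2 * B) := by gcongr
      _ = ζ ^ 2 * a 0 / (t + δ ^ 2) ^ 2 +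
          4 * B * ((t + 3 * δ ^ 2) / (t + 2 * δ ^ 2) ^ 2) := by
        congr 1; field_simp; ring
      _ ≤ ζ ^ 2 * a 0 / (t + δ ^ 2) ^ 2 + 4 * B * (1 / (t + δ ^ 2)) := by
        refine add_le_add_right (mul_le_mul_of_nonneg_left ?_ (by positivity)) _
        -- What remains is `(t + 3δ²)(t + δ²) = (t + 2δ²)² - δ⁴ ≤ (t + 2δ²)²`.
        rw [div_le_div_iff₀ (by positivity) (by positivity)]
        nlinarith [sq_nonneg (δ ^ 2)]
      _ = _ := by ring

theorem norm_sq_eq_dotProduct {n : Type*} [Fintype n] (x : EuclideanSpace ℝ n) :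
    ‖x‖ ^ 2 = x.ofLp ⬝ᵥ x.ofLp := by
  rw [EuclideanSpace.real_norm_sq_eq]
  simp [dotProduct, pow_two]

/-! ### Spectral norm, extreme eigenvalues and condition number. -/

section Spectral

variable {n : Type*} [Fintype n] [DecidableEq n]

theorem dotProduct_mulVec_le_specNorm (B : Matrix n n ℝ) (x : n → ℝ) :
    x ⬝ᵥ (B *ᵥ x) ≤ specNorm B * (x ⬝ᵥ x) := by
  set y : EuclideanSpace ℝ n := WithLp.toLp 2 x with hy
  have h1 : x ⬝ᵥ (B *ᵥ x) = inner ℝ y (toEuclideanCLM (𝕜 := ℝ) B y) := by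
    rw [inner_toEuclideanCLM]
  have h2 : x ⬝ᵥ x = ‖y‖ ^ 2 := by rw [norm_sq_eq_dotProduct]
  rw [h1, h2]
  calc _ ≤ ‖y‖ * ‖toEuclideanCLM (𝕜 := ℝ) B y‖ := real_inner_le_norm _ _
    _ ≤ ‖y‖ * (‖toEuclideanCLM (𝕜 := ℝ) B‖ * ‖y‖) := by
      gcongr; exact ContinuousLinearMap.le_opNorm _ _
    _ = _ := by rw [specNorm]; ring

theorem specNorm_nonneg (B : Matrix n n ℝ) : 0 ≤ specNorm B := norm_nonneg _

theorem exists_eigenvector_of_mem_spectrum {B : Matrix n n ℝ} {μ : ℝ} (h : μ ∈ spectrum ℝ B) :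
    ∃ v : n → ℝ, v ≠ 0 ∧ B *ᵥ v = μ • v := by
  rw [← spectrum_toLin', ← Module.End.hasEigenvalue_iff_mem_spectrum] at h
  obtain ⟨v, hv⟩ := h.exists_hasEigenvector
  exact ⟨v, hv.2, by simpa using hv.apply_eq_smul⟩

theorem lamMin_mem_spectrum [Nonempty n] {B : Matrix n n ℝ} (hB : B.IsHermitian) :
    lamMin B ∈ spectrum ℝ B := by
  refine Set.Nonempty.csInf_mem ?_ (finite_real_spectrum (𝕜 := ℝ) (A := B))
  rw [hB.spectrum_real_eq_range_eigenvalues]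
  exact Set.range_nonempty _

/-- Subtracting the scalar matrix shifts the spectrum into the nonnegative half-line, and a
Hermitian matrix with such a spectrum is positive semidefinite. -/
theorem lamMin_form_le {B : Matrix n n ℝ} (hB : B.IsHermitian) (x : n → ℝ) :
    lamMin B * (x ⬝ᵥ x) ≤ x ⬝ᵥ (B *ᵥ x) := by
  have hpsd : (B - algebraMap ℝ _ (lamMin B)).PosSemidef := by
    rw [posSemidef_iff_isHermitian_and_spectrum_nonneg]
    refine ⟨?_, ?_⟩
    · refine hB.sub ?_
      rw [IsHermitian, Matrix.algebraMap_eq_diagonal, diagonal_conjTranspose]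
      simp
    · rw [← spectrum.sub_singleton_eq]
      rintro _ ⟨a, ha, b, rfl, rfl⟩
      exact sub_nonneg.2 (csInf_le (finite_real_spectrum (𝕜 := ℝ) (A := B)).bddBelow ha)
  have := hpsd.dotProduct_mulVec_nonneg x
  rw [sub_mulVec, dotProduct_sub, Algebra.algebraMap_eq_smul_one, smul_mulVec, one_mulVec,
    dotProduct_smul, star_trivial, smul_eq_mul] at this
  linarith

theorem form_le_lamMax {B : Matrix n n ℝ} (hB : B.IsHermitian) (x : n → ℝ) :
    x ⬝ᵥ (B *ᵥ x) ≤ lamMax B * (x ⬝ᵥ x) := by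
  have hpsd : (algebraMap ℝ _ (lamMax B) - B).PosSemidef := by
    rw [posSemidef_iff_isHermitian_and_spectrum_nonneg]
    refine ⟨?_, ?_⟩
    · refine IsHermitian.sub ?_ hB
      rw [IsHermitian, Matrix.algebraMap_eq_diagonal, diagonal_conjTranspose]
      simp
    · rw [← spectrum.singleton_sub_eq]
      rintro _ ⟨a, rfl, b, hb, rfl⟩
      exact sub_nonneg.2 (le_csSup (finite_real_spectrum (𝕜 := ℝ) (A := B)).bddAbove hb)
  have := hpsd.dotProduct_mulVec_nonneg x
  rw [sub_mulVec, dotProduct_sub, Algebra.algebraMap_eq_smul_one, smul_mulVec, one_mulVec,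
    dotProduct_smul, star_trivial, smul_eq_mul] at this
  linarith

theorem lamMin_pos [Nonempty n] {B : Matrix n n ℝ} (hB : B.PosDef) : 0 < lamMin B := by
  obtain ⟨v, hv, he⟩ := exists_eigenvector_of_mem_spectrum (lamMin_mem_spectrum hB.isHermitian)
  have h1 := hB.dotProduct_mulVec_pos hv
  rw [he, dotProduct_smul, star_trivial, smul_eq_mul] at h1
  exact pos_of_mul_pos_left h1 (dotProduct_self_nonneg_real v)

theorem one_le_condNumber [Nonempty n] {B : Matrix n n ℝ} (hB : IsUnit B.det) :
    1 ≤ condNumber B := by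
  have h : toEuclideanCLM (𝕜 := ℝ) B * toEuclideanCLM (𝕜 := ℝ) B⁻¹ = 1 := by
    rw [← map_mul, mul_nonsing_inv _ hB, map_one]
  calc (1 : ℝ) = ‖toEuclideanCLM (𝕜 := ℝ) B * toEuclideanCLM (𝕜 := ℝ) B⁻¹‖ := by
        rw [h, norm_one]
    _ ≤ _ := norm_mul_le _ _

/-- An eigenvector for the smallest eigenvalue is scaled by `1 / lamMin B` under `B⁻¹`, so `1 ≤
‖B⁻¹‖ lamMin B`. -/
theorem specNorm_le_condNumber_mul_lamMin [Nonempty n] {B : Matrix n n ℝ} (hB : B.PosDef) :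
    specNorm B ≤ condNumber B * lamMin B := by
  obtain ⟨v, hv, he⟩ := exists_eigenvector_of_mem_spectrum (lamMin_mem_spectrum hB.isHermitian)
  have hpos := lamMin_pos hB
  have hu : IsUnit B.det := (Matrix.isUnit_iff_isUnit_det B).1 hB.isUnit
  have he' : lamMin B • (B⁻¹ *ᵥ v) = v := by
    rw [← mulVec_smul, ← he, mulVec_mulVec, nonsing_inv_mul _ hu, one_mulVec]
  have hvv : 0 < v ⬝ᵥ v := lt_of_le_of_ne (dotProduct_self_nonneg_real v)
    fun h => hv (dotProduct_self_eq_zero.1 h.symm)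
  have h1 : 1 ≤ specNorm B⁻¹ * lamMin B := by
    have := mul_le_mul_of_nonneg_left (dotProduct_mulVec_le_specNorm B⁻¹ v) hpos.le
    rw [← smul_eq_mul, ← dotProduct_smul, he'] at this
    refine le_of_mul_le_mul_right ?_ hvv
    linarith
  calc specNorm B = specNorm B * 1 := (mul_one _).symm
    _ ≤ specNorm B * (specNorm B⁻¹ * lamMin B) := by
      gcongr; exact specNorm_nonneg B
    _ = _ := by rw [condNumber]; ring

end Spectral

/-! ### The constants of the saddle-point problem. -/

section Constants

variable {d : ℕ} {A M : Matrix (Fin d) (Fin d) ℝ}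

theorem isHermitian_schur (hM : M.PosDef) : (Aᵀ * M⁻¹ * A).IsHermitian := by
  have := isHermitian_conjTranspose_mul_mul A hM.inv.isHermitian
  rwa [conjTranspose_eq_transpose_of_trivial] at this

theorem posDef_schur (hA : IsUnit A.det) (hM : M.PosDef) : (Aᵀ * M⁻¹ * A).PosDef := by
  have := hM.inv.conjTranspose_mul_mul_same (B := A) (mulVec_injective_iff_isUnit.2
    ((Matrix.isUnit_iff_isUnit_det A).2 hA))
  rwa [conjTranspose_eq_transpose_of_trivial] at this

theorem dotProduct_schur (u : Fin d → ℝ) :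
    u ⬝ᵥ ((Aᵀ * M⁻¹ * A) *ᵥ u) = (A *ᵥ u) ⬝ᵥ (M⁻¹ *ᵥ (A *ᵥ u)) := by
  rw [mulVec_dotProduct_eq, mulVec_mulVec, mulVec_mulVec, Matrix.mul_assoc]

theorem delta_pos (hd : 0 < d) (hA : IsUnit A.det) (hM : M.PosDef) : 0 < delta A M :=
  haveI : Nonempty (Fin d) := ⟨⟨0, hd⟩⟩
  lamMin_pos (posDef_schur hA hM)

theorem delta_le_rho (hd : 0 < d) (hM : M.PosDef) : delta A M ≤ rho A M := by
  have : Nonempty (Fin d) := ⟨⟨0, hd⟩⟩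
  have h := lamMin_mem_spectrum (isHermitian_schur (A := A) hM)
  exact le_csSup (finite_real_spectrum (𝕜 := ℝ) (A := Aᵀ * M⁻¹ * A)).bddAbove h

theorem beta_pos (hd : 0 < d) (hA : IsUnit A.det) (hM : M.PosDef) : 0 < beta A M := by
  have : Nonempty (Fin d) := ⟨⟨0, hd⟩⟩
  have h1 := (delta_pos hd hA hM).trans_le (delta_le_rho hd hM)
  have h2 := lamMin_pos hM
  rw [beta]
  positivity

/-- `A Aᵀ ≤ ρ M` is the dual form of `Aᵀ M⁻¹ A ≤ ρ`. It follows by testing the form of `M` on `ρ x -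
M⁻¹ A Aᵀ x`. -/
theorem transpose_mulVec_sq_le (hd : 0 < d) (hA : IsUnit A.det) (hM : M.PosDef)
    (x : Fin d → ℝ) : (Aᵀ *ᵥ x) ⬝ᵥ (Aᵀ *ᵥ x) ≤ rho A M * (x ⬝ᵥ (M *ᵥ x)) := by
  have hρ := (delta_pos hd hA hM).trans_le (delta_le_rho hd hM)
  have hu : IsUnit M.det := (Matrix.isUnit_iff_isUnit_det M).1 hM.isUnit
  have hMt : Mᵀ = M := hM.isHermitian
  set u := Aᵀ *ᵥ x with hud
  set t := M⁻¹ *ᵥ (A *ᵥ u) with ht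
  have hMt' : M *ᵥ t = A *ᵥ u := by
    rw [ht, mulVec_mulVec, mul_nonsing_inv _ hu, one_mulVec]
  have h0 := hM.posSemidef.dotProduct_mulVec_nonneg (rho A M • x - t)
  have h1 := form_le_lamMax (isHermitian_schur (A := A) hM) u
  rw [dotProduct_schur, ← ht] at h1
  change _ ≤ rho A M * _ at h1
  have e1 : x ⬝ᵥ (A *ᵥ u) = u ⬝ᵥ u := by
    rw [dotProduct_comm, mulVec_dotProduct_eq]
  have e2 : t ⬝ᵥ (M *ᵥ x) = u ⬝ᵥ u := by
    rw [dotProduct_comm, mulVec_dotProduct_eq, hMt, hMt', e1]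
  have e3 : t ⬝ᵥ (A *ᵥ u) = (A *ᵥ u) ⬝ᵥ t := dotProduct_comm _ _
  simp only [star_trivial, mulVec_sub, mulVec_smul, dotProduct_sub, sub_dotProduct,
    smul_dotProduct, dotProduct_smul, smul_eq_mul, hMt', e1, e2, e3] at h0
  have : 0 ≤ rho A M * (rho A M * (x ⬝ᵥ (M *ᵥ x)) - u ⬝ᵥ u) := by linarith
  have := nonneg_of_mul_nonneg_right this hρ
  linarith

/-- The scaled blocks `√β A` and `β M` of the joint system meet the hypotheses of
`symmetrizer_drift` and `symmetrizer_bounds`. -/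
theorem scaled_blocks (hd : 0 < d) (hA : IsUnit A.det) (hM : M.PosDef) :
    (∀ x, 8 * rho A M * (x ⬝ᵥ x) ≤ x ⬝ᵥ ((beta A M • M) *ᵥ x)) ∧
    (∀ x, x ⬝ᵥ ((beta A M • M) *ᵥ x) ≤ 8 * rho A M * condNumber M * (x ⬝ᵥ x)) ∧
    (∀ x, ((√(beta A M) • A)ᵀ *ᵥ x) ⬝ᵥ ((√(beta A M) • A)ᵀ *ᵥ x) ≤
      rho A M * (x ⬝ᵥ ((beta A M • M) *ᵥ x))) ∧
    (∀ u, delta A M * (u ⬝ᵥ u) ≤ ((√(beta A M) • A) *ᵥ u) ⬝ᵥ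
      ((beta A M • M)⁻¹ *ᵥ ((√(beta A M) • A) *ᵥ u))) := by
  have : Nonempty (Fin d) := ⟨⟨0, hd⟩⟩
  have hρ := (delta_pos hd hA hM).trans_le (delta_le_rho hd hM)
  have hβ := beta_pos hd hA hM
  have hm := lamMin_pos hM
  -- This is the purpose of the choice of `β`. The scaling leaves `Aᵀ M⁻¹ A` unchanged, since `√β ·
  -- β⁻¹ · √β = 1`.
  have hβm : beta A M * lamMin M = 8 * rho A M := by
    rw [beta]; field_simp
  have hsq : √(beta A M) * √(beta A M) = beta A M := Real.mul_self_sqrt hβ.le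
  refine ⟨fun x => ?_, fun x => ?_, fun x => ?_, fun u => ?_⟩
  · rw [smul_mulVec, dotProduct_smul, smul_eq_mul, ← hβm, mul_assoc]
    exact mul_le_mul_of_nonneg_left (lamMin_form_le hM.isHermitian x) hβ.le
  · rw [smul_mulVec, dotProduct_smul, smul_eq_mul, ← hβm]
    calc _ ≤ beta A M * (specNorm M * (x ⬝ᵥ x)) :=
          mul_le_mul_of_nonneg_left (dotProduct_mulVec_le_specNorm M x) hβ.le
      _ ≤ beta A M * ((condNumber M * lamMin M) * (x ⬝ᵥ x)) := by
          gcongr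
          · exact dotProduct_self_nonneg_real x
          · exact specNorm_le_condNumber_mul_lamMin hM
      _ = _ := by ring
  · rw [transpose_smul, smul_mulVec, smul_mulVec, dotProduct_smul, smul_dotProduct,
      dotProduct_smul, smul_eq_mul, smul_eq_mul, smul_eq_mul, ← mul_assoc, hsq]
    calc _ ≤ beta A M * (rho A M * (x ⬝ᵥ (M *ᵥ x))) :=
          mul_le_mul_of_nonneg_left (transpose_mulVec_sq_le hd hA hM x) hβ.le
      _ = _ := by ring
  · have hinv : (beta A M • M)⁻¹ = (beta A M)⁻¹ • M⁻¹ :=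
      Matrix.inv_smul' M (Units.mk0 _ hβ.ne') ((Matrix.isUnit_iff_isUnit_det M).1 hM.isUnit)
    have h := lamMin_form_le (isHermitian_schur (A := A) hM) u
    rw [dotProduct_schur] at h
    rw [hinv]
    simp only [smul_mulVec, mulVec_smul, dotProduct_smul, smul_dotProduct, smul_eq_mul]
    calc _ ≤ _ := h
      _ = (√(beta A M) * √(beta A M)) * (beta A M)⁻¹ * ((A *ᵥ u) ⬝ᵥ (M⁻¹ *ᵥ (A *ᵥ u))) := by
        rw [hsq, mul_inv_cancel₀ hβ.ne', one_mul]
      _ = _ := by ring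

end Constants

/-! ### Sums over paths and bounded functions of a path. -/

/-- The weight `v (x n) T(x n, x (n-1)) ⋯ T(x 1, x 0) g (x 0)` summed over all paths. -/
theorem sum_path_eq_pow {α : Type*} [Fintype α] [DecidableEq α] (T : Matrix α α ℝ) (n : ℕ)
    (v g : α → ℝ) :
    ∑ x : Fin (n + 1) → α, v (x (Fin.last n)) * (∏ l : Fin n, T (x l.succ) (x l.castSucc)) *
      g (x 0) = v ⬝ᵥ (T ^ n *ᵥ g) := by
  induction n generalizing g with
  | zero =>
    rw [← (Equiv.funUnique (Fin 1) α).symm.sum_comp]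
    simp [dotProduct]
  | succ n ih =>
    -- The most recent position `x 0` is split off and absorbed into `g`, which becomes `T g`; for
    -- this the induction leaves `g` general.
    rw [pow_succ, ← mulVec_mulVec, ← ih, ← (Fin.consEquiv fun _ => α).sum_comp,
      Fintype.sum_prod_type_right]
    refine Finset.sum_congr rfl fun x _ => ?_
    simp only [Fin.consEquiv_apply, Fin.prod_univ_succ (n := n), Fin.cons_succ, Fin.castSucc_zero,
      Fin.cons_zero, mulVec, dotProduct, Finset.mul_sum, ← Fin.succ_last, ← Fin.succ_castSucc]
    refine Finset.sum_congr rfl fun y _ => ?_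
    ring

namespace Problem

section Local

variable {S Act : Type*}

/-- The function that a path defines when it is kept constant after `n` steps. -/
theorem truncate_eq (F : (ℕ → S × Act) → S → ℝ) (n : ℕ) (x : ℕ → S × Act) (s' : S) :
    F (fun j => x (min j n)) s' =
      F (fun j => (fun i : Fin (n + 1) => x i) (Fin.ofNat (n + 1) (min j n))) s' := by
  have : ∀ j, min j n % (n + 1) = min j n := fun j =>
    Nat.mod_eq_of_lt (Nat.lt_succ_of_le (min_le_right _ _))
  simp [Fin.ofNat, this]

/-- A bounded function of a path and a state that is the limit of its values at the truncated
paths. -/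
structure BoundedLocal (F : (ℕ → S × Act) → S → ℝ) : Prop where
  bounded : ∃ C, ∀ x s, |F x s| ≤ C
  tendsto : ∀ x s, Filter.Tendsto (fun n => F (fun j => x (min j n)) s) Filter.atTop
    (nhds (F x s))

namespace BoundedLocal

variable {F F₁ F₂ : (ℕ → S × Act) → S → ℝ}

theorem const (c : ℝ) : BoundedLocal fun (_ : ℕ → S × Act) (_ : S) => c where
  bounded := ⟨|c|, fun _ _ => le_rfl⟩
  tendsto _ _ := tendsto_const_nhds

theorem add (h₁ : BoundedLocal F₁) (h₂ : BoundedLocal F₂) :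
    BoundedLocal fun x s => F₁ x s + F₂ x s where
  bounded := by
    obtain ⟨C₁, h₁⟩ := h₁.bounded
    obtain ⟨C₂, h₂⟩ := h₂.bounded
    exact ⟨C₁ + C₂, fun x s => (abs_add_le _ _).trans (add_le_add (h₁ x s) (h₂ x s))⟩
  tendsto x s := (h₁.tendsto x s).add (h₂.tendsto x s)

theorem mul (h₁ : BoundedLocal F₁) (h₂ : BoundedLocal F₂) :
    BoundedLocal fun x s => F₁ x s * F₂ x s where
  bounded := by
    obtain ⟨C₁, h₁⟩ := h₁.bounded
    obtain ⟨C₂, h₂⟩ := h₂.bounded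
    refine ⟨C₁ * C₂, fun x s => ?_⟩
    rw [abs_mul]
    exact mul_le_mul (h₁ x s) (h₂ x s) (abs_nonneg _) ((abs_nonneg _).trans (h₁ x s))
  tendsto x s := (h₁.tendsto x s).mul (h₂.tendsto x s)

theorem neg (h : BoundedLocal F) : BoundedLocal fun x s => -F x s := by
  simpa using (const (-1)).mul h

theorem sub (h₁ : BoundedLocal F₁) (h₂ : BoundedLocal F₂) :
    BoundedLocal fun x s => F₁ x s - F₂ x s := by
  simpa [sub_eq_add_neg] using h₁.add h₂.neg

theorem sum {ι : Type*} (t : Finset ι) {F : ι → (ℕ → S × Act) → S → ℝ}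
    (h : ∀ i, BoundedLocal (F i)) : BoundedLocal fun x s => ∑ i ∈ t, F i x s := by
  classical
  induction t using Finset.induction_on with
  | empty => simpa using const 0
  | insert i t hi ih => simpa [Finset.sum_insert hi] using (h i).add ih

end BoundedLocal

end Local

variable {S Act : Type*} [Fintype S] [Fintype Act] {d : ℕ}

/-! ### The Neumann series of the trace matrix. -/

section Neumann

attribute [local instance] Matrix.linftyOpNormedRing Matrix.linftyOpNormedAlgebra

/-- For the maximal row-sum norm: since `κ ≤ 1`, each row of `P^{κμ}` is dominated by a probability
vector. -/
theorem norm_smul_traceMatrix_lt_one [DecidableEq S] [DecidableEq Act] (p : Problem S Act d)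
    (rule : TraceRule) : ‖(p.lam * p.gam) • p.traceMatrix rule‖ < 1 := by
  have h0 : 0 ≤ p.lam * p.gam := mul_nonneg p.lam_nonneg p.gam_nonneg
  have h1 : p.lam * p.gam < 1 :=
    (mul_le_of_le_one_left p.gam_nonneg p.lam_le_one).trans_lt p.gam_lt_one
  have h2 : ‖p.traceMatrix rule‖ ≤ 1 := by
    rw [linfty_opNorm_def, ← NNReal.coe_one, NNReal.coe_le_coe]
    refine Finset.sup_le fun x _ => ?_
    rw [← NNReal.coe_le_coe, NNReal.coe_sum]
    have hnn : ∀ y : S × Act, 0 ≤ p.trans x.1 x.2 y.1 * p.behavior y.1 y.2 := fun y =>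
      mul_nonneg (p.trans_nonneg _ _ _) (p.behavior_nonneg _ _)
    calc ∑ y, ((‖p.traceMatrix rule x y‖₊ : NNReal) : ℝ)
        ≤ ∑ y : S × Act, p.trans x.1 x.2 y.1 * p.behavior y.1 y.2 := by
          refine Finset.sum_le_sum fun y _ => ?_
          rw [coe_nnnorm, traceMatrix, of_apply,
            Real.norm_of_nonneg (mul_nonneg (hnn y) (p.kappa_nonneg rule y))]
          exact mul_le_of_le_one_right (hnn y) (p.kappa_le_one rule y)
      _ = 1 := by
          rw [Fintype.sum_prod_type]
          simp only [← Finset.mul_sum, p.behavior_sum, mul_one, p.trans_sum]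
  calc _ ≤ ‖p.lam * p.gam‖ * ‖p.traceMatrix rule‖ := norm_smul_le _ _
    _ ≤ ‖p.lam * p.gam‖ * 1 := by gcongr
    _ < 1 := by rwa [mul_one, Real.norm_of_nonneg h0]

theorem hasSum_resolvent [DecidableEq S] [DecidableEq Act] (p : Problem S Act d)
    (rule : TraceRule) :
    HasSum (fun j : ℕ => ((p.lam * p.gam) • p.traceMatrix rule) ^ j)
      (1 - (p.lam * p.gam) • p.traceMatrix rule)⁻¹ := by
  have h := p.norm_smul_traceMatrix_lt_one rule
  have hs := (summable_geometric_of_norm_lt_one h).hasSum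
  rwa [← inv_eq_left_inv (geom_series_mul_neg _ h)] at hs

end Neumann

theorem hasSum_resolvent_form [DecidableEq S] [DecidableEq Act] (p : Problem S Act d)
    (rule : TraceRule) (v g : S × Act → ℝ) :
    HasSum (fun j : ℕ => (p.lam * p.gam) ^ j * (v ⬝ᵥ (p.traceMatrix rule ^ j *ᵥ g)))
      (v ⬝ᵥ ((1 - (p.lam * p.gam) • p.traceMatrix rule)⁻¹ *ᵥ g)) := by
  have h := p.hasSum_resolvent rule
  have hc : Continuous fun B : Matrix (S × Act) (S × Act) ℝ => v ⬝ᵥ (B *ᵥ g) := by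
    unfold dotProduct mulVec dotProduct
    fun_prop
  let L : Matrix (S × Act) (S × Act) ℝ →+ ℝ :=
    { toFun := fun B => v ⬝ᵥ (B *ᵥ g)
      map_zero' := by simp
      map_add' := fun B C => by rw [add_mulVec, dotProduct_add] }
  have := h.map L hc
  have e : (L ∘ fun j : ℕ => ((p.lam * p.gam) • p.traceMatrix rule) ^ j) =
      fun j : ℕ => (p.lam * p.gam) ^ j * (v ⬝ᵥ (p.traceMatrix rule ^ j *ᵥ g)) := by
    funext j
    simp [L, smul_pow, smul_mulVec, dotProduct_smul]
  rwa [e] at this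

/-! ### Expectations under the law of a stationary sample. -/

section Law

variable {Ω : Type*} [MeasurableSpace Ω] {P : Measure Ω}
  {X : ℕ → Ω → S × Act} {S' : Ω → S}

/-- The mass of a path `x 0, …, x n` (backwards in time) followed by the state `s'`. -/
def pathMass (p : Problem S Act d) {n : ℕ} (x : Fin (n + 1) → S × Act) (s' : S) : ℝ :=
  p.stat (x (Fin.last n)) *
    (∏ l : Fin n, p.trans (x l.succ).1 (x l.succ).2 (x l.castSucc).1 *
      p.behavior (x l.castSucc).1 (x l.castSucc).2) * p.trans (x 0).1 (x 0).2 s'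

theorem measurable_path {Ω : Type*} {m : MeasurableSpace Ω} {X : ℕ → Ω → S × Act} {S' : Ω → S}
    (hX : ∀ j, @Measurable Ω (S × Act) m ⊤ (X j)) (hS : @Measurable Ω S m ⊤ S') (n : ℕ) :
    @Measurable Ω ((Fin (n + 1) → S × Act) × S) m ⊤
      fun ω => (fun j : Fin (n + 1) => X j ω, S' ω) := by
  let _ : MeasurableSpace (S × Act) := ⊤
  let _ : MeasurableSpace S := ⊤
  let _ : MeasurableSpace ((Fin (n + 1) → S × Act) × S) := ⊤
  refine measurable_to_countable' fun y => ?_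
  have : (fun ω => ((fun j : Fin (n + 1) => X j ω, S' ω) : (Fin (n + 1) → S × Act) × S)) ⁻¹' {y} =
      (⋂ j : Fin (n + 1), X j ⁻¹' {y.1 j}) ∩ S' ⁻¹' {y.2} := by
    ext ω
    simp [Prod.ext_iff, funext_iff]
  rw [this]
  exact (MeasurableSet.iInter fun j : Fin (n + 1) => hX j trivial).inter (hS trivial)

variable [IsProbabilityMeasure P]

theorem integral_path {p : Problem S Act d} (h : p.IsStationarySample P X S') (n : ℕ)
    (F : (Fin (n + 1) → S × Act) → S → ℝ) :
    ∫ ω, F (fun j => X j ω) (S' ω) ∂P =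
      ∑ x : Fin (n + 1) → S × Act, ∑ s', p.pathMass x s' * F x s' := by
  let _ : MeasurableSpace ((Fin (n + 1) → S × Act) × S) := ⊤
  have hm := measurable_path h.measurable_pair h.measurable_next n
  have : IsProbabilityMeasure (P.map fun ω => ((fun j : Fin (n + 1) => X j ω, S' ω) :
      (Fin (n + 1) → S × Act) × S)) := Measure.isProbabilityMeasure_map hm.aemeasurable
  rw [← integral_map (φ := fun ω => ((fun j : Fin (n + 1) => X j ω, S' ω) :
      (Fin (n + 1) → S × Act) × S)) (f := fun y => F y.1 y.2) hm.aemeasurable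
    (measurable_from_top.aestronglyMeasurable), integral_fintype .of_finite,
    Fintype.sum_prod_type]
  refine Finset.sum_congr rfl fun x _ => Finset.sum_congr rfl fun s' _ => ?_
  rw [smul_eq_mul, map_measureReal_apply hm trivial]
  congr 1
  -- The finite path is extended to all of `ℕ` by reducing the index modulo `n + 1`; the cylinder
  -- only sees the indices up to `n`, where nothing changes.
  have hl := h.law n (fun j => x (Fin.ofNat (n + 1) j)) s'
  have hcast : ∀ j : Fin (n + 1), Fin.ofNat (n + 1) (j : ℕ) = j := fun j => by
    simp
  rw [Finset.prod_range] at hl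
  have e1 : ∀ l : Fin n, Fin.ofNat (n + 1) ((l : ℕ) + 1) = l.succ := fun l => hcast l.succ
  have e2 : ∀ l : Fin n, Fin.ofNat (n + 1) (l : ℕ) = l.castSucc := fun l => hcast l.castSucc
  have e3 : Fin.ofNat (n + 1) n = Fin.last n := hcast (Fin.last n)
  have e4 : Fin.ofNat (n + 1) 0 = 0 := hcast 0
  simp only [e1, e2, e3, e4] at hl
  rw [pathMass, ← hl]
  congr 1
  ext ω
  simp only [Set.mem_preimage, Set.mem_singleton_iff, Prod.mk.injEq, Set.mem_ofPred_eq, funext_iff]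
  refine and_congr ⟨fun H j hj => ?_, fun H j => ?_⟩ Iff.rfl
  · have := H ⟨j, Nat.lt_succ_of_le hj⟩
    rw [this]
    congr 1
    exact (hcast ⟨j, Nat.lt_succ_of_le hj⟩).symm
  · have := H j (Nat.le_of_lt_succ j.2)
    rwa [hcast] at this

end Law

theorem norm_eligibility_term_le (p : Problem S Act d) (rule : TraceRule) (i : Fin d)
    (x : ℕ → S × Act) (j : ℕ) :
    ‖(p.lam * p.gam) ^ j * (∏ l ∈ Finset.range j, p.kappa rule (x l)) *
      p.feat (x j).1 (x j).2 i‖ ≤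
      (p.lam * p.gam) ^ j * ∑ y : S × Act, |p.feat y.1 y.2 i| := by
  have h0 : 0 ≤ p.lam * p.gam := mul_nonneg p.lam_nonneg p.gam_nonneg
  have hp0 : 0 ≤ ∏ l ∈ Finset.range j, p.kappa rule (x l) :=
    Finset.prod_nonneg fun l _ => p.kappa_nonneg rule _
  have hp1 : ∏ l ∈ Finset.range j, p.kappa rule (x l) ≤ 1 :=
    Finset.prod_le_one (fun l _ => p.kappa_nonneg rule _) fun l _ => p.kappa_le_one rule _
  have hf : |p.feat (x j).1 (x j).2 i| ≤ ∑ y : S × Act, |p.feat y.1 y.2 i| :=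
    Finset.single_le_sum (f := fun y : S × Act => |p.feat y.1 y.2 i|)
      (fun y _ => abs_nonneg _) (Finset.mem_univ (x j))
  rw [Real.norm_eq_abs, abs_mul, abs_mul, abs_of_nonneg (pow_nonneg h0 j), abs_of_nonneg hp0,
    mul_assoc]
  refine mul_le_mul_of_nonneg_left ?_ (pow_nonneg h0 j)
  calc _ ≤ 1 * |p.feat (x j).1 (x j).2 i| := by gcongr
    _ ≤ _ := by rw [one_mul]; exact hf

namespace BoundedLocal

variable {F : (ℕ → S × Act) → S → ℝ}

theorem of_current (h : S × Act → S → ℝ) :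
    BoundedLocal fun (x : ℕ → S × Act) s => h (x 0) s where
  bounded := ⟨∑ y, ∑ s, |h y s|, fun x s =>
    (Finset.single_le_sum (f := fun s => |h (x 0) s|) (fun _ _ => abs_nonneg _)
      (Finset.mem_univ s)).trans (Finset.single_le_sum (f := fun y => ∑ s, |h y s|)
        (fun _ _ => Finset.sum_nonneg fun _ _ => abs_nonneg _) (Finset.mem_univ (x 0)))⟩
  tendsto x s := by simp

/-- A geometric bound uniform in the path dominates the series, and the `j`-th term does not change
under truncation at any `n ≥ j`; so dominated convergence for series applies. -/
theorem eligibility (p : Problem S Act d) (rule : TraceRule) (i : Fin d) :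
    BoundedLocal fun x (_ : S) => p.eligibility rule x i := by
  have h0 : 0 ≤ p.lam * p.gam := mul_nonneg p.lam_nonneg p.gam_nonneg
  have h1 : p.lam * p.gam < 1 :=
    (mul_le_of_le_one_left p.gam_nonneg p.lam_le_one).trans_lt p.gam_lt_one
  set C := ∑ y : S × Act, |p.feat y.1 y.2 i| with hC
  have hb := p.norm_eligibility_term_le rule i
  have hs : Summable fun j => (p.lam * p.gam) ^ j * C :=
    (summable_geometric_of_lt_one h0 h1).mul_right _
  refine ⟨⟨∑' j, (p.lam * p.gam) ^ j * C, fun x _ => ?_⟩, fun x _ => ?_⟩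
  · exact tsum_of_norm_bounded hs.hasSum (hb x)
  · refine tendsto_tsum_of_dominated_convergence hs (fun j => ?_)
      (Filter.Eventually.of_forall fun n j => hb _ j)
    refine tendsto_const_nhds.congr' ?_
    filter_upwards [Filter.eventually_ge_atTop j] with n hn
    rw [min_eq_left hn]
    congr 2
    refine Finset.prod_congr rfl fun l hl => ?_
    rw [min_eq_left ((Finset.mem_range.1 hl).le.trans hn)]

theorem measurable {Ω : Type*} {m : MeasurableSpace Ω} {X : ℕ → Ω → S × Act} {S' : Ω → S}
    (hF : BoundedLocal F) (hX : ∀ j, @Measurable Ω (S × Act) m ⊤ (X j))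
    (hS : @Measurable Ω S m ⊤ S') : Measurable fun ω => F (fun j => X j ω) (S' ω) := by
  refine measurable_of_tendsto_metrizable
    (f := fun n ω => F (fun j => X (min j n) ω) (S' ω)) (fun n => ?_)
    (tendsto_pi_nhds.2 fun ω => hF.tendsto _ _)
  let _ : MeasurableSpace ((Fin (n + 1) → S × Act) × S) := ⊤
  have := (measurable_from_top (f := fun y : (Fin (n + 1) → S × Act) × S =>
    F (fun j => y.1 (Fin.ofNat (n + 1) (min j n))) y.2)).comp (measurable_path hX hS n)
  convert this using 1
  funext ω
  exact truncate_eq F n (fun j => X j ω) (S' ω)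

/-- The law of a stationary sample determines the integrals of bounded local functions. -/
theorem integral_eq {Ω : Type*} [MeasurableSpace Ω] {P : Measure Ω} [IsProbabilityMeasure P]
    {X X₂ : ℕ → Ω → S × Act} {S' S₂ : Ω → S} {p : Problem S Act d} (hF : BoundedLocal F)
    (h : p.IsStationarySample P X S') (h₂ : p.IsStationarySample P X₂ S₂) :
    ∫ ω, F (fun j => X j ω) (S' ω) ∂P = ∫ ω, F (fun j => X₂ j ω) (S₂ ω) ∂P := by
  obtain ⟨C, hC⟩ := hF.bounded
  -- The law is prescribed on cylinders only. The approximating sums involve only the path masses of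
  -- `p`, so two stationary samples share one sequence and hence its limit.
  have hlim : ∀ {X : ℕ → Ω → S × Act} {S' : Ω → S}, p.IsStationarySample P X S' →
      Filter.Tendsto (fun n => ∑ x : Fin (n + 1) → S × Act, ∑ s', p.pathMass x s' *
        F (fun j => x (Fin.ofNat (n + 1) (min j n))) s') Filter.atTop
        (nhds (∫ ω, F (fun j => X j ω) (S' ω) ∂P)) := by
    intro X S' h
    have e : ∀ n, ∑ x : Fin (n + 1) → S × Act, ∑ s', p.pathMass x s' *
        F (fun j => x (Fin.ofNat (n + 1) (min j n))) s' =
        ∫ ω, F (fun j => X (min j n) ω) (S' ω) ∂P := by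
      intro n
      rw [← integral_path h n fun x s' => F (fun j => x (Fin.ofNat (n + 1) (min j n))) s']
      exact integral_congr_ae (Filter.Eventually.of_forall fun ω =>
        (truncate_eq F n (fun j => X j ω) (S' ω)).symm)
    simp only [e]
    refine tendsto_integral_of_dominated_convergence (fun _ => C) (fun n => ?_)
      (integrable_const _) (fun n => Filter.Eventually.of_forall fun ω => hC _ _)
      (Filter.Eventually.of_forall fun ω => hF.tendsto _ _)
    have hm : Measurable fun ω => F (fun j => X (min j n) ω) (S' ω) := by
      let _ : MeasurableSpace ((Fin (n + 1) → S × Act) × S) := ⊤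
      have := (measurable_from_top (f := fun y : (Fin (n + 1) → S × Act) × S =>
        F (fun j => y.1 (Fin.ofNat (n + 1) (min j n))) y.2)).comp
          (measurable_path h.measurable_pair h.measurable_next n)
      convert this using 1
      funext ω
      exact truncate_eq F n (fun j => X j ω) (S' ω)
    exact hm.aestronglyMeasurable
  exact tendsto_nhds_unique (hlim h) (hlim h₂)

end BoundedLocal

section Expectation

variable {Ω : Type*} [MeasurableSpace Ω] {P : Measure Ω} [IsProbabilityMeasure P]
  {X : ℕ → Ω → S × Act} {S' : Ω → S}

/-- The factor `κ (x l)` joins the transition from `x (l+1)` to `x l` in the path mass, and the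
product is an entry of `P^{κμ}`. -/
theorem integral_trace_term [DecidableEq S] [DecidableEq Act] {p : Problem S Act d}
    (h : p.IsStationarySample P X S') (rule : TraceRule) (f : S × Act → ℝ) (q : S × Act → S → ℝ)
    (n : ℕ) :
    ∫ ω, (∏ l ∈ Finset.range n, p.kappa rule (X l ω)) * f (X n ω) * q (X 0 ω) (S' ω) ∂P =
      (fun x => p.stat x * f x) ⬝ᵥ
        (p.traceMatrix rule ^ n *ᵥ fun x => ∑ s', p.trans x.1 x.2 s' * q x s') := by
  have := integral_path h n fun x s' =>
    (∏ l : Fin n, p.kappa rule (x l.castSucc)) * f (x (Fin.last n)) * q (x 0) s'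
  simp only [Fin.val_castSucc, Fin.val_last, Fin.val_zero] at this
  simp only [Finset.prod_range]
  rw [this, ← sum_path_eq_pow]
  refine Finset.sum_congr rfl fun x _ => ?_
  rw [Finset.mul_sum]
  refine Finset.sum_congr rfl fun s' _ => ?_
  simp only [traceMatrix, of_apply, Finset.prod_mul_distrib, pathMass]
  ring

/-- The expectation of the eligibility trace times a function of the current transition. -/
theorem integral_eligibility_mul [DecidableEq S] [DecidableEq Act] {p : Problem S Act d}
    (h : p.IsStationarySample P X S') (rule : TraceRule) (i : Fin d) (q : S × Act → S → ℝ) :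
    ∫ ω, p.eligibility rule (fun j => X j ω) i * q (X 0 ω) (S' ω) ∂P =
      (fun x => p.stat x * p.feat x.1 x.2 i) ⬝ᵥ
        ((1 - (p.lam * p.gam) • p.traceMatrix rule)⁻¹ *ᵥ
          fun x => ∑ s', p.trans x.1 x.2 s' * q x s') := by
  have h0 : 0 ≤ p.lam * p.gam := mul_nonneg p.lam_nonneg p.gam_nonneg
  have h1 : p.lam * p.gam < 1 :=
    (mul_le_of_le_one_left p.gam_nonneg p.lam_le_one).trans_lt p.gam_lt_one
  obtain ⟨C, hC⟩ := (BoundedLocal.of_current q).bounded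
  have hs : Summable fun j => (p.lam * p.gam) ^ j * (∑ y : S × Act, |p.feat y.1 y.2 i|) * C :=
    ((summable_geometric_of_lt_one h0 h1).mul_right _).mul_right _
  have hq : Measurable fun ω => q (X 0 ω) (S' ω) :=
    (BoundedLocal.of_current q).measurable h.measurable_pair h.measurable_next
  have hmeas : ∀ j, Measurable fun ω => (p.lam * p.gam) ^ j *
      (∏ l ∈ Finset.range j, p.kappa rule (X l ω)) * p.feat (X j ω).1 (X j ω).2 i *
        q (X 0 ω) (S' ω) := fun j =>
    (((Finset.measurable_fun_prod _ fun l _ =>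
      Measurable.comp (g := p.kappa rule) measurable_from_top (h.measurable_pair l)).const_mul
        _).mul (Measurable.comp (g := fun y : S × Act => p.feat y.1 y.2 i) measurable_from_top
          (h.measurable_pair j))).mul hq
  -- Sum and integral are exchanged. Term by term the result is the Neumann series `key2`, and
  -- uniqueness of sums identifies the limits.
  have key := hasSum_integral_of_dominated_convergence (μ := P)
    (F := fun j ω => (p.lam * p.gam) ^ j *
      (∏ l ∈ Finset.range j, p.kappa rule (X l ω)) * p.feat (X j ω).1 (X j ω).2 i *
        q (X 0 ω) (S' ω))
    (fun j _ => (p.lam * p.gam) ^ j * (∑ y : S × Act, |p.feat y.1 y.2 i|) * C)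
    (fun j => (hmeas j).aestronglyMeasurable)
    (fun j => Filter.Eventually.of_forall fun ω => by
      rw [norm_mul]
      exact mul_le_mul (p.norm_eligibility_term_le rule i (fun j => X j ω) j)
        (hC (fun j => X j ω) (S' ω)) (norm_nonneg _) (mul_nonneg (pow_nonneg h0 j)
          (Finset.sum_nonneg fun _ _ => abs_nonneg _)))
    (Filter.Eventually.of_forall fun _ => hs) (integrable_const _)
    (Filter.Eventually.of_forall fun ω =>
      (p.eligibility_summable rule (fun j => X j ω) i).hasSum.mul_right _)
  have key2 := p.hasSum_resolvent_form rule (fun x => p.stat x * p.feat x.1 x.2 i)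
    fun x => ∑ s', p.trans x.1 x.2 s' * q x s'
  refine key.unique (Eq.mp (congrArg (HasSum · _) (funext fun j => ?_)) key2)
  rw [← integral_trace_term h rule (fun x => p.feat x.1 x.2 i) q j, ← integral_const_mul]
  simp only [mul_assoc]

end Expectation

end Problem

/-! ### Unbiasedness of the estimates and the update of the joint variable. -/

namespace Problem

variable {S Act : Type*} [Fintype S] [Fintype Act] {d : ℕ}

/-- `G`, with blocks `0`, `√β Aᵀ`, `-√β A`, `β M`. -/
def jointMatrix (β : ℝ) (A M : Matrix (Fin d) (Fin d) ℝ) :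
    Matrix (Fin d ⊕ Fin d) (Fin d ⊕ Fin d) ℝ :=
  Matrix.fromBlocks 0 (√β • A.transpose) (-(√β • A)) (β • M)

section Local

theorem boundedLocal_estA (p : Problem S Act d) (rule : TraceRule) (i j : Fin d) :
    BoundedLocal fun x s => p.estA rule x s i j :=
  (BoundedLocal.eligibility p rule i).mul (.of_current fun y s => p.featDiff y s j)

theorem boundedLocal_estb (p : Problem S Act d) (rule : TraceRule) (i : Fin d) :
    BoundedLocal fun x (_ : S) => p.estb rule x i :=
  (BoundedLocal.of_current fun y (_ : S) => p.reward y.1 y.2).mul (.eligibility p rule i)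

theorem boundedLocal_estM (p : Problem S Act d) (form : DualForm) (i j : Fin d) :
    BoundedLocal fun x (_ : S) => p.estM form x i j := by
  cases form with
  | covariance =>
    exact .of_current fun y (_ : S) => p.feat y.1 y.2 i * p.feat y.1 y.2 j
  | identity => exact .const _

theorem boundedLocal_estG (p : Problem S Act d) (rule : TraceRule) (form : DualForm) (β : ℝ)
    (a b : Fin d ⊕ Fin d) : BoundedLocal fun x s => p.estG rule form β x s a b := by
  rcases a with i | i <;> rcases b with j | j
  · exact .const 0
  · exact (BoundedLocal.const _).mul (p.boundedLocal_estA rule j i)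
  · exact ((BoundedLocal.const _).mul (p.boundedLocal_estA rule i j)).neg
  · exact (BoundedLocal.const _).mul (p.boundedLocal_estM form i j)

theorem boundedLocal_estg (p : Problem S Act d) (rule : TraceRule) (β : ℝ)
    (a : Fin d ⊕ Fin d) : BoundedLocal fun x (_ : S) => p.estg rule β x a := by
  rcases a with i | i
  · exact .const 0
  · exact (BoundedLocal.const _).mul (p.boundedLocal_estb rule i)

end Local

section Expectation

variable {Ω : Type*} [MeasurableSpace Ω] {P : Measure Ω} [IsProbabilityMeasure P]
  {X : ℕ → Ω → S × Act} {S' : Ω → S}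

theorem integral_current {p : Problem S Act d} (h : p.IsStationarySample P X S')
    (f : S × Act → ℝ) : ∫ ω, f (X 0 ω) ∂P = ∑ y, p.stat y * f y := by
  have := integral_path h 0 fun x _ => f (x 0)
  simp only [Fin.val_zero] at this
  rw [this, ← (Equiv.funUnique (Fin 1) (S × Act)).symm.sum_comp]
  refine Finset.sum_congr rfl fun y _ => ?_
  simp [pathMass, ← Finset.sum_mul, ← Finset.mul_sum, p.trans_sum]

variable [DecidableEq S] [DecidableEq Act]

theorem integral_estA {p : Problem S Act d} (h : p.IsStationarySample P X S')
    (rule : TraceRule) (i j : Fin d) :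
    ∫ ω, p.estA rule (fun j => X j ω) (S' ω) i j ∂P = p.matA rule i j := by
  have := integral_eligibility_mul h rule i fun y s => p.featDiff y s j
  refine this.trans ?_
  have hD : (fun x : S × Act => ∑ s', p.trans x.1 x.2 s' * p.featDiff x s' j) =
      fun x => ((p.gam • p.targetMatrix - 1) * p.featMatrix : Matrix (S × Act) (Fin d) ℝ) x j := by
    funext x
    rw [Matrix.sub_mul, Matrix.one_mul, Matrix.smul_mul, Matrix.sub_apply, Matrix.smul_apply, mul_apply,
      Fintype.sum_prod_type]
    simp only [featDiff, meanFeat, Pi.sub_apply, Pi.smul_apply, smul_eq_mul, mul_sub,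
      Finset.sum_sub_distrib, ← Finset.sum_mul, p.trans_sum, one_mul, targetMatrix, featMatrix,
      of_apply]
    congr 1
    rw [Finset.mul_sum]
    refine Finset.sum_congr rfl fun s _ => ?_
    simp only [Finset.mul_sum]
    refine Finset.sum_congr rfl fun a _ => ?_
    ring
  rw [hD, matA, Matrix.mul_assoc, Matrix.mul_assoc, mul_apply]
  refine Finset.sum_congr rfl fun x _ => ?_
  rw [mul_diagonal, mul_apply]
  simp only [mulVec, dotProduct, transpose_apply, featMatrix, of_apply]
  ring

theorem integral_estb {p : Problem S Act d} (h : p.IsStationarySample P X S')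
    (rule : TraceRule) (i : Fin d) :
    ∫ ω, p.estb rule (fun j => X j ω) i ∂P = p.vecb rule i := by
  have := integral_eligibility_mul h rule i fun y _ => p.reward y.1 y.2
  simp only [estb, Pi.smul_apply, smul_eq_mul]
  simp only [mul_comm (p.reward _ _)]
  refine this.trans ?_
  simp only [← Finset.sum_mul, p.trans_sum, one_mul]
  rw [vecb, ← mulVec_mulVec]
  simp only [mulVec, dotProduct, mul_diagonal, transpose_apply, featMatrix, of_apply]
  refine Finset.sum_congr rfl fun x _ => ?_
  ring

theorem integral_estM {p : Problem S Act d} (h : p.IsStationarySample P X S')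
    (form : DualForm) (i j : Fin d) :
    ∫ ω, p.estM form (fun j => X j ω) i j ∂P = p.matM form i j := by
  cases form with
  | covariance =>
    refine (integral_current h fun y => p.feat y.1 y.2 i * p.feat y.1 y.2 j).trans ?_
    rw [matM, mul_apply]
    simp only [mul_diagonal, transpose_apply, featMatrix, of_apply]
    refine Finset.sum_congr rfl fun x _ => ?_
    ring
  | identity => simp [estM, matM]

theorem integral_estG {p : Problem S Act d} (h : p.IsStationarySample P X S')
    (rule : TraceRule) (form : DualForm) (β : ℝ) (a b : Fin d ⊕ Fin d) :
    ∫ ω, p.estG rule form β (fun j => X j ω) (S' ω) a b ∂P =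
      jointMatrix β (p.matA rule) (p.matM form) a b := by
  rcases a with i | i <;> rcases b with j | j <;>
    simp [estG, jointMatrix, integral_const_mul, integral_neg, integral_estA h, integral_estM h]

theorem integral_estg {p : Problem S Act d} (h : p.IsStationarySample P X S')
    (rule : TraceRule) (β : ℝ) (a : Fin d ⊕ Fin d) :
    ∫ ω, p.estg rule β (fun j => X j ω) a ∂P =
      (Sum.elim 0 (√β • p.vecb rule) : Fin d ⊕ Fin d → ℝ) a := by
  rcases a with i | i <;> simp [estg, integral_const_mul, integral_estb h]

/-- The solution is the zero of the mean update. -/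
theorem jointMatrix_mulVec_solution (p : Problem S Act d) (rule : TraceRule) (form : DualForm)
    (β : ℝ) (hA : IsUnit (p.matA rule).det) :
    jointMatrix β (p.matA rule) (p.matM form) *ᵥ (p.solution rule β).ofLp =
      (Sum.elim 0 (√β • p.vecb rule) : Fin d ⊕ Fin d → ℝ) := by
  simp [jointMatrix, solution, joint, fromBlocks_mulVec, neg_mulVec, smul_mulVec, mulVec_neg,
    mulVec_mulVec, mul_nonsing_inv _ hA]

theorem matM_posSemidef (p : Problem S Act d) (form : DualForm) :
    (p.matM form).PosSemidef := by
  cases form with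
  | covariance =>
    have := (PosSemidef.diagonal (d := p.stat) p.stat_nonneg).conjTranspose_mul_mul_same
      p.featMatrix
    rwa [conjTranspose_eq_transpose_of_trivial] at this
  | identity => exact PosSemidef.one

end Expectation

/-- One step of the algorithm in the joint variable. -/
theorem jointIterate_succ (p : Problem S Act d) (rule : TraceRule) (form : DualForm) (α : ℕ → ℝ)
    {β : ℝ} (hβ : 0 < β) (x : ℕ → ℕ → S × Act) (s' : ℕ → S) (θ₀ ω₀ : Fin d → ℝ) (k : ℕ) :
    (p.jointIterate rule form α β x s' θ₀ ω₀ (k + 1)).ofLp =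
      (p.jointIterate rule form α β x s' θ₀ ω₀ k).ofLp - α k •
        (p.estG rule form β (x k) (s' k) *ᵥ (p.jointIterate rule form α β x s' θ₀ ω₀ k).ofLp -
          p.estg rule β (x k)) := by
  have hs : √β ≠ 0 := (Real.sqrt_pos.2 hβ).ne'
  have hsq : √β * √β = β := Real.mul_self_sqrt hβ.le
  simp only [jointIterate, iterates, joint, estG, estg, fromBlocks_mulVec]
  generalize (p.iterates rule form α β x s' θ₀ ω₀ k).1 = θ
  generalize (p.iterates rule form α β x s' θ₀ ω₀ k).2 = w
  have hA : p.estA rule (x k) (s' k) *ᵥ θ =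
      (p.featDiff (x k 0) (s' k) ⬝ᵥ θ) • p.eligibility rule (x k) := by
    rw [estA, vecMulVec_mulVec, op_smul_eq_smul]
  have hAt : (p.estA rule (x k) (s' k))ᵀ *ᵥ w =
      (p.eligibility rule (x k) ⬝ᵥ w) • p.featDiff (x k 0) (s' k) := by
    rw [estA, transpose_vecMulVec, vecMulVec_mulVec, op_smul_eq_smul]
  have htd : p.tdError θ (x k 0) (s' k) =
      p.featDiff (x k 0) (s' k) ⬝ᵥ θ + p.reward (x k 0).1 (x k 0).2 := by
    rw [tdError, featDiff, sub_dotProduct, smul_dotProduct, smul_eq_mul, dotProduct_comm θ,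
      dotProduct_comm θ]
    ring
  funext a
  rcases a with i | i
  · simp only [Sum.elim_comp_inl, Sum.elim_comp_inr, Sum.elim_inl, zero_mulVec, smul_mulVec,
      mulVec_smul, hAt, Pi.sub_apply, Pi.add_apply, Pi.smul_apply, smul_eq_mul, Pi.zero_apply]
    rw [dotProduct_comm w]
    field_simp
    ring
  · simp only [Sum.elim_comp_inl, Sum.elim_comp_inr, Sum.elim_inr, neg_mulVec, smul_mulVec,
      mulVec_smul, hA, Pi.sub_apply, Pi.add_apply, Pi.smul_apply, smul_eq_mul, Pi.neg_apply, htd,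
      estb]
    field_simp
    rw [Real.sq_sqrt hβ.le]
    ring

end Problem

/-! ### One stochastic affine step. -/

section Step

theorem sum_form_eq {ι : Type*} [Fintype ι] (B : Matrix ι ι ℝ) (x y : ι → ℝ) :
    ∑ c : ι × ι, B c.1 c.2 * (x c.1 * y c.2) = x ⬝ᵥ (B *ᵥ y) := by
  rw [Fintype.sum_prod_type]
  simp only [dotProduct, mulVec, Finset.mul_sum]
  exact Finset.sum_congr rfl fun a _ => Finset.sum_congr rfl fun b _ => by ring

variable {Ω : Type*} {m₁ m₂ : MeasurableSpace Ω} [m₀ : MeasurableSpace Ω] {P : Measure Ω}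

variable {ι : Type*} [Fintype ι]

theorem memLp_mulVec {D : Ω → ι → ℝ} (hD : ∀ a, MemLp (fun ω => D ω a) 2 P) (H : Matrix ι ι ℝ)
    (a : ι) : MemLp (fun ω => (H *ᵥ D ω) a) 2 P :=
  memLp_finsetSum _ fun b _ => (hD b).const_mul (H a b)

theorem integrable_form {D : Ω → ι → ℝ} (hD : ∀ a, MemLp (fun ω => D ω a) 2 P)
    (H : Matrix ι ι ℝ) : Integrable (fun ω => D ω ⬝ᵥ (H *ᵥ D ω)) P :=
  integrable_finsetSum _ fun a _ => (hD a).integrable_mul (memLp_mulVec hD H a)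

variable [IsProbabilityMeasure P]

theorem integrable_of_measurable_of_bounded {F : Ω → ℝ} (hF : Measurable F)
    (hb : ∃ C, ∀ ω, |F ω| ≤ C) : Integrable F P := by
  obtain ⟨C, hC⟩ := hb
  exact Integrable.of_bound hF.aestronglyMeasurable C (Filter.Eventually.of_forall hC)

/-- This replaces conditioning on the past: in a bilinear expression the coefficients from the
current sample may be exchanged for their means. -/
theorem integral_sum_mul_of_indep (h₁ : m₁ ≤ m₀) (hind : Indep m₁ m₂ P)
    {κ : Type*} [Fintype κ] {F Y : κ → Ω → ℝ} (hF : ∀ i, Measurable[m₁] (F i))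
    (hFb : ∀ i, ∃ C, ∀ ω, |F i ω| ≤ C) (hY : ∀ i, Measurable[m₂] (Y i))
    (hYi : ∀ i, Integrable (Y i) P) :
    Integrable (fun ω => ∑ i, F i ω * Y i ω) P ∧
      ∫ ω, ∑ i, F i ω * Y i ω ∂P = ∫ ω, ∑ i, (∫ ω', F i ω' ∂P) * Y i ω ∂P := by
  have hindep : ∀ i, IndepFun (F i) (Y i) P := fun i => by
    rw [IndepFun_iff_Indep]
    exact indep_of_indep_of_le_left (indep_of_indep_of_le_right hind (hY i).comap_le)
      (hF i).comap_le
  have hFi : ∀ i, Integrable (F i) P := fun i =>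
    integrable_of_measurable_of_bounded ((hF i).mono h₁ le_rfl) (hFb i)
  have hi : ∀ i, Integrable (fun ω => F i ω * Y i ω) P := fun i =>
    (hindep i).integrable_mul (hFi i) (hYi i)
  refine ⟨integrable_finsetSum _ fun i _ => hi i, ?_⟩
  rw [integral_finsetSum _ fun i _ => hi i,
    integral_finsetSum _ fun i _ => (hYi i).const_mul _]
  refine Finset.sum_congr rfl fun i _ => ?_
  rw [integral_const_mul]
  exact (hindep i).integral_mul_eq_mul_integral (hFi i).aestronglyMeasurable
    (hYi i).aestronglyMeasurable

theorem memLp_affine_step {G : Ω → Matrix ι ι ℝ} {f D : Ω → ι → ℝ}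
    (hG : ∀ a b, Measurable fun ω => G ω a b) (hGb : ∀ a b, ∃ C, ∀ ω, |G ω a b| ≤ C)
    (hf : ∀ a, Measurable fun ω => f ω a) (hfb : ∀ a, ∃ C, ∀ ω, |f ω a| ≤ C)
    (hD : ∀ a, MemLp (fun ω => D ω a) 2 P) (a : ι) :
    MemLp (fun ω => (G ω *ᵥ D ω + f ω) a) 2 P := by
  refine MemLp.add (f := fun ω => (G ω *ᵥ D ω) a) ?_ ?_
  · refine memLp_finsetSum _ fun b _ => ?_
    obtain ⟨C, hC⟩ := hGb a b
    refine MemLp.of_le_mul (c := C) (hD b) ((hG a b).aestronglyMeasurable.mul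
      (hD b).aestronglyMeasurable) (Filter.Eventually.of_forall fun ω => ?_)
    rw [norm_mul]
    exact mul_le_mul_of_nonneg_right (hC ω) (norm_nonneg _)
  · obtain ⟨C, hC⟩ := hfb a
    exact MemLp.of_bound (hf a).aestronglyMeasurable C (Filter.Eventually.of_forall hC)

theorem integral_sq_mulVec_of_indep (h₁ : m₁ ≤ m₀) (hind : Indep m₁ m₂ P)
    {G : Ω → Matrix ι ι ℝ} {D : Ω → ι → ℝ}
    (hG : ∀ a b, Measurable[m₁] fun ω => G ω a b) (hGb : ∀ a b, ∃ C, ∀ ω, |G ω a b| ≤ C)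
    (hDm : ∀ a, Measurable[m₂] fun ω => D ω a) (hD : ∀ a, MemLp (fun ω => D ω a) 2 P)
    {Q : Matrix ι ι ℝ} (hQ : ∀ a b, ∫ ω, ((G ω)ᵀ * G ω) a b ∂P = Q a b) :
    Integrable (fun ω => D ω ⬝ᵥ (((G ω)ᵀ * G ω) *ᵥ D ω)) P ∧
      ∫ ω, D ω ⬝ᵥ (((G ω)ᵀ * G ω) *ᵥ D ω) ∂P = ∫ ω, D ω ⬝ᵥ (Q *ᵥ D ω) ∂P := by
  have hGG : ∀ a b, Measurable[m₁] fun ω => ((G ω)ᵀ * G ω) a b := fun a b =>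
    Finset.measurable_fun_sum _ fun c _ => (hG c a).mul (hG c b)
  have hGGb : ∀ a b, ∃ C, ∀ ω, |((G ω)ᵀ * G ω) a b| ≤ C := fun a b => by
    choose C hC using hGb
    refine ⟨∑ c, C c a * C c b, fun ω => ?_⟩
    rw [mul_apply]
    refine (Finset.abs_sum_le_sum_abs _ _).trans (Finset.sum_le_sum fun c _ => ?_)
    rw [abs_mul]
    exact mul_le_mul (hC c a ω) (hC c b ω) (abs_nonneg _) ((abs_nonneg _).trans (hC c a ω))
  obtain ⟨i3, e3⟩ := integral_sum_mul_of_indep h₁ hind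
    (F := fun (c : ι × ι) ω => ((G ω)ᵀ * G ω) c.1 c.2) (Y := fun c ω => D ω c.1 * D ω c.2)
    (fun c => hGG c.1 c.2) (fun c => hGGb c.1 c.2) (fun c => (hDm c.1).mul (hDm c.2))
    (fun c => (hD c.1).integrable_mul (hD c.2))
  simp only [sum_form_eq ((G _)ᵀ * G _)] at i3 e3
  simp only [hQ, sum_form_eq] at e3
  exact ⟨i3, e3⟩

/-- The expected decrease of a quadratic form along a stochastic affine step whose mean contracts
that form. -/
theorem expected_form_step_le (h₁ : m₁ ≤ m₀) (hind : Indep m₁ m₂ P)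
    {G : Ω → Matrix ι ι ℝ} {f D : Ω → ι → ℝ}
    (hG : ∀ a b, Measurable[m₁] fun ω => G ω a b) (hGb : ∀ a b, ∃ C, ∀ ω, |G ω a b| ≤ C)
    (hf : ∀ a, Measurable[m₁] fun ω => f ω a) (hfb : ∀ a, ∃ C, ∀ ω, |f ω a| ≤ C)
    (hf0 : ∀ a, ∫ ω, f ω a ∂P = 0)
    (hDm : ∀ a, Measurable[m₂] fun ω => D ω a) (hD : ∀ a, MemLp (fun ω => D ω a) 2 P)
    {H Gm Q : Matrix ι ι ℝ} {δ l h L α : ℝ} (hl : 0 < l) (hh : 0 ≤ h) (hL0 : 0 ≤ L) (hα : 0 ≤ α)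
    (hGm : ∀ a b, ∫ ω, G ω a b ∂P = Gm a b)
    (hQ : ∀ a b, ∫ ω, ((G ω)ᵀ * G ω) a b ∂P = Q a b)
    (hL : ∀ x, x ⬝ᵥ (Q *ᵥ x) ≤ L * (x ⬝ᵥ x))
    (hH : Hᵀ = H) (hHl : ∀ x, l * (x ⬝ᵥ x) ≤ x ⬝ᵥ (H *ᵥ x))
    (hHh : ∀ x, x ⬝ᵥ (H *ᵥ x) ≤ h * (x ⬝ᵥ x))
    (hdrift : ∀ x, δ * (x ⬝ᵥ (H *ᵥ x)) ≤ (H *ᵥ x) ⬝ᵥ (Gm *ᵥ x)) :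
    ∫ ω, (D ω - α • (G ω *ᵥ D ω + f ω)) ⬝ᵥ (H *ᵥ (D ω - α • (G ω *ᵥ D ω + f ω))) ∂P ≤
      (1 - 2 * δ * α + 2 * (h / l * L) * α ^ 2) * ∫ ω, D ω ⬝ᵥ (H *ᵥ D ω) ∂P +
        α ^ 2 * (2 * h * ∫ ω, f ω ⬝ᵥ f ω ∂P) := by
  have ns := dotProduct_self_nonneg_real (n := ι)
  have hHn : ∀ x, 0 ≤ x ⬝ᵥ (H *ᵥ x) := fun x => (mul_nonneg hl.le (ns x)).trans (hHl x)
  have hHDm : ∀ a, Measurable[m₂] fun ω => (H *ᵥ D ω) a := fun a =>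
    Finset.measurable_fun_sum _ fun b _ => (hDm b).const_mul (H a b)
  have hHD := memLp_mulVec hD H
  -- the three expectations
  obtain ⟨i1, e1⟩ := integral_sum_mul_of_indep h₁ hind
    (F := fun (c : ι × ι) ω => G ω c.1 c.2) (Y := fun c ω => (H *ᵥ D ω) c.1 * D ω c.2)
    (fun c => hG c.1 c.2) (fun c => hGb c.1 c.2) (fun c => (hHDm c.1).mul (hDm c.2))
    (fun c => (hHD c.1).integrable_mul (hD c.2))
  obtain ⟨i2, e2⟩ := integral_sum_mul_of_indep h₁ hind
    (F := fun a ω => f ω a) (Y := fun a ω => (H *ᵥ D ω) a) hf hfb hHDm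
    (fun a => (hHD a).integrable one_le_two)
  obtain ⟨i3, e3⟩ := integral_sq_mulVec_of_indep h₁ hind hG hGb hDm hD hQ
  simp only [sum_form_eq (G _)] at i1 e1
  simp only [hGm, sum_form_eq] at e1
  simp only [hf0, zero_mul, Finset.sum_const_zero, integral_zero] at e2
  have e1' : δ * ∫ ω, D ω ⬝ᵥ (H *ᵥ D ω) ∂P ≤ ∫ ω, (H *ᵥ D ω) ⬝ᵥ (G ω *ᵥ D ω) ∂P := by
    rw [e1, ← integral_const_mul]
    refine integral_mono ((integrable_form hD H).const_mul _) ?_ fun ω => hdrift _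
    exact integrable_finsetSum _ fun a _ => (hHD a).integrable_mul (memLp_mulVec hD Gm a)
  have e3' : ∫ ω, D ω ⬝ᵥ (((G ω)ᵀ * G ω) *ᵥ D ω) ∂P ≤
      L / l * ∫ ω, D ω ⬝ᵥ (H *ᵥ D ω) ∂P := by
    rw [e3, ← integral_const_mul]
    refine integral_mono (integrable_form hD Q) ((integrable_form hD H).const_mul _) fun ω => ?_
    refine (hL _).trans ?_
    rw [div_mul_eq_mul_div, le_div_iff₀ hl]
    have := mul_le_mul_of_nonneg_left (hHl (D ω)) hL0
    linarith
  have hfi : Integrable (fun ω => f ω ⬝ᵥ f ω) P := by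
    refine integrable_finsetSum _ fun a _ => ?_
    obtain ⟨C, hC⟩ := hfb a
    refine integrable_of_measurable_of_bounded
      (((hf a).mono h₁ le_rfl).mul ((hf a).mono h₁ le_rfl)) ⟨C * C, fun ω => ?_⟩
    rw [abs_mul]
    exact mul_le_mul (hC ω) (hC ω) (abs_nonneg _) ((abs_nonneg _).trans (hC ω))
  have hsum : ∀ ω, ∑ i, f ω i * (H *ᵥ D ω) i = (H *ᵥ D ω) ⬝ᵥ f ω := fun ω =>
    dotProduct_comm (f ω) (H *ᵥ D ω)
  simp only [hsum] at i2 e2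
  have hpt : ∀ ω, (D ω - α • (G ω *ᵥ D ω + f ω)) ⬝ᵥ (H *ᵥ (D ω - α • (G ω *ᵥ D ω + f ω))) ≤
      D ω ⬝ᵥ (H *ᵥ D ω) - 2 * α * ((H *ᵥ D ω) ⬝ᵥ (G ω *ᵥ D ω)) -
        2 * α * ((H *ᵥ D ω) ⬝ᵥ f ω) +
        2 * α ^ 2 * h * (D ω ⬝ᵥ (((G ω)ᵀ * G ω) *ᵥ D ω)) + 2 * α ^ 2 * h * (f ω ⬝ᵥ f ω) := by
    intro ω
    have hGD : D ω ⬝ᵥ (((G ω)ᵀ * G ω) *ᵥ D ω) = (G ω *ᵥ D ω) ⬝ᵥ (G ω *ᵥ D ω) := by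
      rw [← mulVec_mulVec, ← mulVec_dotProduct_eq]
    rw [hGD]
    generalize G ω *ᵥ D ω = y
    generalize f ω = w
    generalize D ω = x
    have hsym : ∀ u v : ι → ℝ, u ⬝ᵥ (H *ᵥ v) = (H *ᵥ u) ⬝ᵥ v := fun u v => by
      rw [mulVec_dotProduct_eq, hH]
    -- Positivity of `H` at `y - w` bounds its form at `y + w` by twice the sum of its forms at `y`
    -- and `w`. This separates multiplicative from additive noise at the cost of a factor `2`.
    have a1 := hHn (y - w)
    have a2 := hHh y
    have a3 := hHh w
    simp only [mulVec_sub, mulVec_add, mulVec_smul, dotProduct_sub, dotProduct_add, sub_dotProduct,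
      add_dotProduct, smul_dotProduct, dotProduct_smul, smul_eq_mul] at a1 ⊢
    have s1 : y ⬝ᵥ (H *ᵥ x) = (H *ᵥ x) ⬝ᵥ y := dotProduct_comm _ _
    have s2 : w ⬝ᵥ (H *ᵥ x) = (H *ᵥ x) ⬝ᵥ w := dotProduct_comm _ _
    have s3 : w ⬝ᵥ (H *ᵥ y) = y ⬝ᵥ (H *ᵥ w) := by rw [dotProduct_comm, hsym y w]
    rw [s3] at a1
    rw [hsym x y, hsym x w, s1, s2, s3]
    have a4 := mul_le_mul_of_nonneg_left a2 (sq_nonneg α)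
    have a5 := mul_le_mul_of_nonneg_left a3 (sq_nonneg α)
    have a6 := mul_nonneg (sq_nonneg α) a1
    linarith
  have hV := integrable_form hD H
  have j1 := i1.const_mul (2 * α)
  have j2 := i2.const_mul (2 * α)
  have j3 := i3.const_mul (2 * α ^ 2 * h)
  have j4 := hfi.const_mul (2 * α ^ 2 * h)
  have hint := integral_mono_of_nonneg (Filter.Eventually.of_forall fun ω => hHn _)
    ((((hV.sub j1).sub j2).add j3).add j4) (Filter.Eventually.of_forall hpt)
  refine hint.trans ?_
  rw [integral_add' (((hV.sub j1).sub j2).add j3) j4, integral_add' ((hV.sub j1).sub j2) j3,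
    integral_sub' (hV.sub j1) j2, integral_sub' hV j1, integral_const_mul, integral_const_mul,
    integral_const_mul, integral_const_mul, e2]
  have k1 := mul_le_mul_of_nonneg_left e1' hα
  have k3 := mul_le_mul_of_nonneg_left e3' (by positivity : 0 ≤ 2 * α ^ 2 * h)
  have k4 : 2 * α ^ 2 * h * (L / l * ∫ ω, D ω ⬝ᵥ (H *ᵥ D ω) ∂P) =
      2 * (h / l * L) * α ^ 2 * ∫ ω, D ω ⬝ᵥ (H *ᵥ D ω) ∂P := by ring
  rw [k4] at k3
  linarith

end Step

/-! ### The symmetrizer in the joint variable. -/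

section Symmetrizer

variable {d : ℕ} {A M : Matrix (Fin d) (Fin d) ℝ}

/-- The matrix of the quadratic form that the mean update of the joint iterate contracts. -/
def symmetrizer (A M : Matrix (Fin d) (Fin d) ℝ) : Matrix (Fin d ⊕ Fin d) (Fin d ⊕ Fin d) ℝ :=
  fromBlocks ((4 * rho A M) • 1) (-(√(beta A M) • A)ᵀ) (-(√(beta A M) • A))
    (beta A M • M - (4 * rho A M) • 1)

theorem symmetrizer_mulVec (u w : Fin d → ℝ) :
    symmetrizer A M *ᵥ Sum.elim u w =
      Sum.elim ((4 * rho A M) • u - (√(beta A M) • A)ᵀ *ᵥ w)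
        ((beta A M • M) *ᵥ w - (√(beta A M) • A) *ᵥ u - (4 * rho A M) • w) := by
  rw [symmetrizer, fromBlocks_mulVec, Sum.elim_comp_inl, Sum.elim_comp_inr, neg_mulVec, neg_mulVec,
    sub_mulVec, smul_mulVec _ (1 : Matrix (Fin d) (Fin d) ℝ),
    smul_mulVec _ (1 : Matrix (Fin d) (Fin d) ℝ), one_mulVec, one_mulVec]
  congr 1
  abel

theorem symmetrizer_form (u w : Fin d → ℝ) :
    Sum.elim u w ⬝ᵥ (symmetrizer A M *ᵥ Sum.elim u w) =
      4 * rho A M * (u ⬝ᵥ u) - 2 * (((√(beta A M) • A) *ᵥ u) ⬝ᵥ w) +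
        w ⬝ᵥ ((beta A M • M) *ᵥ w) - 4 * rho A M * (w ⬝ᵥ w) := by
  rw [symmetrizer_mulVec, sumElim_dotProduct_sumElim, dotProduct_sub, dotProduct_sub,
    dotProduct_sub, dotProduct_smul, dotProduct_smul, smul_eq_mul, smul_eq_mul,
    ← mulVec_dotProduct_eq, dotProduct_comm w ((√(beta A M) • A) *ᵥ u)]
  ring

theorem symmetrizer_transpose (hM : M.PosDef) : (symmetrizer A M)ᵀ = symmetrizer A M := by
  have hMt : Mᵀ = M := hM.isHermitian
  rw [symmetrizer, fromBlocks_transpose]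
  simp [hMt]

theorem le_symmetrizer_form (hd : 0 < d) (hA : IsUnit A.det) (hM : M.PosDef)
    (x : Fin d ⊕ Fin d → ℝ) :
    rho A M * (x ⬝ᵥ x) ≤ x ⬝ᵥ (symmetrizer A M *ᵥ x) ∧
      x ⬝ᵥ (symmetrizer A M *ᵥ x) ≤ 8 * rho A M * condNumber M * (x ⬝ᵥ x) := by
  have : Nonempty (Fin d) := ⟨⟨0, hd⟩⟩
  obtain ⟨h1, h2, h3, -⟩ := scaled_blocks hd hA hM
  have hρ := (delta_pos hd hA hM).trans_le (delta_le_rho hd hM)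
  rw [← Sum.elim_comp_inl_inr x, symmetrizer_form, sumElim_dotProduct_sumElim]
  exact symmetrizer_bounds hρ (one_le_condNumber ((Matrix.isUnit_iff_isUnit_det M).1 hM.isUnit))
    h1 h2 h3 _ _

theorem symmetrizer_form_contraction (hd : 0 < d) (hA : IsUnit A.det) (hM : M.PosDef)
    (x : Fin d ⊕ Fin d → ℝ) :
    delta A M * (x ⬝ᵥ (symmetrizer A M *ᵥ x)) ≤
      (symmetrizer A M *ᵥ x) ⬝ᵥ (Problem.jointMatrix (beta A M) A M *ᵥ x) := by
  obtain ⟨h1, -, h3, h4⟩ := scaled_blocks hd hA hM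
  have hδ := delta_pos hd hA hM
  have hρ := hδ.trans_le (delta_le_rho hd hM)
  have hYt : (beta A M • M)ᵀ = beta A M • M := by
    rw [transpose_smul]; congr 1; exact hM.isHermitian
  have hG : ∀ u w : Fin d → ℝ, Problem.jointMatrix (beta A M) A M *ᵥ Sum.elim u w =
      Sum.elim ((√(beta A M) • A)ᵀ *ᵥ w) ((beta A M • M) *ᵥ w - (√(beta A M) • A) *ᵥ u) := by
    intro u w
    rw [Problem.jointMatrix, fromBlocks_mulVec, Sum.elim_comp_inl, Sum.elim_comp_inr, neg_mulVec,
      zero_mulVec, zero_add, transpose_smul, neg_add_eq_sub]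
  rw [← Sum.elim_comp_inl_inr x, symmetrizer_form, symmetrizer_mulVec, hG,
    sumElim_dotProduct_sumElim]
  exact symmetrizer_drift hρ hδ (delta_le_rho hd hM) hYt h1 h3 h4 _ _

end Symmetrizer

/-! ### Measurability and square-integrability by coordinates. -/

section EuclideanCoordinates

theorem measurable_of_coord {Ω ι : Type*} [MeasurableSpace Ω] {z : Ω → EuclideanSpace ℝ ι}
    (hz : ∀ a, Measurable fun ω => z ω a) : Measurable z := by
  exact (MeasurableEquiv.toLp 2 (ι → ℝ)).measurable.comp (measurable_pi_iff.2 hz)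

theorem measurable_coord {Ω ι : Type*} [Fintype ι] {m : MeasurableSpace Ω} {z : Ω → EuclideanSpace ℝ ι}
    (hz : Measurable[m] z) (a : ι) : Measurable[m] fun ω => z ω a :=
  (EuclideanSpace.proj (𝕜 := ℝ) a).continuous.measurable.comp hz

variable {Ω : Type*} [MeasurableSpace Ω] {P : Measure Ω} {ι : Type*} [Fintype ι]

theorem memLp_coord {z : Ω → EuclideanSpace ℝ ι} (hz : MemLp z 2 P) (a : ι) :
    MemLp (fun ω => z ω a) 2 P :=
  hz.of_le ((EuclideanSpace.proj (𝕜 := ℝ) a).continuous.comp_aestronglyMeasurable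
    hz.aestronglyMeasurable) (Filter.Eventually.of_forall fun ω => PiLp.norm_apply_le (z ω) a)

theorem memLp_of_coord {z : Ω → EuclideanSpace ℝ ι} (hm : Measurable z)
    (hz : ∀ a, MemLp (fun ω => z ω a) 2 P) : MemLp z 2 P := by
  rw [memLp_two_iff_integrable_sq_norm hm.aestronglyMeasurable]
  simp only [EuclideanSpace.real_norm_sq_eq]
  exact integrable_finsetSum _ fun a _ => (hz a).integrable_sq

end EuclideanCoordinates

/-! ### Step sizes and the constant `ζ`. -/

section Steps

variable {d : ℕ} {A M : Matrix (Fin d) (Fin d) ℝ}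

theorem stepSize_eq (LG : ℝ) (k : ℕ) :
    stepSize A M LG k = 2 * (8 / 9 * delta A M) /
      ((8 / 9 * delta A M) ^ 2 * (k + 2) + zeta A M LG) := by
  rw [stepSize]
  conv_rhs => rw [← mul_div_mul_left _ _ (by norm_num : (81 : ℝ) ≠ 0)]
  congr 1 <;> ring

theorem zeta_pos (hd : 0 < d) (hA : IsUnit A.det) (hM : M.PosDef) {LG : ℝ} (hLG : 0 ≤ LG) :
    0 < zeta A M LG := by
  have : Nonempty (Fin d) := ⟨⟨0, hd⟩⟩
  have hρ := (delta_pos hd hA hM).trans_le (delta_le_rho hd hM)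
  have hc := one_le_condNumber ((Matrix.isUnit_iff_isUnit_det M).1 hM.isUnit)
  have : 0 < condNumber M := by linarith
  rw [zeta]
  positivity

/-- This is the condition on `η` in `recursion_bound` for the rate `8δ/9`. The terms in `L_G` agree
exactly, and `c(M) ≥ 1`, `δ ≤ ρ` leave ample room for the rest. -/
theorem zeta_slack (hd : 0 < d) (hA : IsUnit A.det) (hM : M.PosDef) (LG : ℝ) :
    16 * condNumber M * LG + (8 / 9 * delta A M) ^ 2 / 4 ≤ zeta A M LG / 2 := by
  have : Nonempty (Fin d) := ⟨⟨0, hd⟩⟩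
  have hδ := delta_pos hd hA hM
  have h := delta_le_rho (A := A) hd hM
  have hc := one_le_condNumber ((Matrix.isUnit_iff_isUnit_det M).1 hM.isUnit)
  have h1 : delta A M ^ 2 ≤ rho A M ^ 2 := pow_le_pow_left₀ hδ.le h 2
  have h2 : (1 : ℝ) ≤ condNumber M ^ 2 := one_le_pow₀ hc
  have h3 : rho A M ^ 2 ≤ condNumber M ^ 2 * rho A M ^ 2 :=
    le_mul_of_one_le_left (sq_nonneg _) h2
  rw [zeta]
  nlinarith [sq_nonneg (rho A M)]

end Steps

theorem dotProduct_sub_self_le {ι : Type*} [Fintype ι] {η : ℝ} (hη : 0 < η) (x y : ι → ℝ) :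
    (x - y) ⬝ᵥ (x - y) ≤ (1 + η) * (x ⬝ᵥ x) + (1 + 1 / η) * (y ⬝ᵥ y) := by
  have h := dotProduct_self_nonneg_real (η • x + y)
  simp only [dotProduct_add, add_dotProduct, dotProduct_sub, sub_dotProduct, smul_dotProduct,
    dotProduct_smul, smul_eq_mul] at h ⊢
  rw [dotProduct_comm y x] at *
  have h2 : 0 ≤ 1 / η * (η * (η * (x ⬝ᵥ x)) + x ⬝ᵥ y * η + (η * (x ⬝ᵥ y) + y ⬝ᵥ y)) :=
    mul_nonneg (by positivity) (by linarith)
  have h3 : 1 / η * (η * (η * (x ⬝ᵥ x)) + x ⬝ᵥ y * η + (η * (x ⬝ᵥ y) + y ⬝ᵥ y)) =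
      η * (x ⬝ᵥ x) + 2 * (x ⬝ᵥ y) + 1 / η * (y ⬝ᵥ y) := by
    field_simp
    ring
  linarith

/-- Letting first the error and then the splitting parameter tend to zero. -/
theorem le_of_forall_young {q s c L : ℝ} {E : ℕ → ℝ} (hE : Filter.Tendsto E Filter.atTop (nhds 0))
    (h : ∀ η : ℝ, 0 < η → ∀ k, q ≤ (1 + η) * (s * (1 + ((1 + η) * c + (1 + 1 / η) * E k))) +
      (1 + 1 / η) * (L * E k)) : q ≤ s * (1 + c) := by
  have h1 : ∀ η : ℝ, 0 < η → q ≤ (1 + η) * (s * (1 + (1 + η) * c)) := fun η hη => by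
    have ht : Filter.Tendsto (fun k => (1 + η) * (s * (1 + ((1 + η) * c + (1 + 1 / η) * E k))) +
        (1 + 1 / η) * (L * E k)) Filter.atTop
        (nhds ((1 + η) * (s * (1 + ((1 + η) * c + (1 + 1 / η) * 0))) +
          (1 + 1 / η) * (L * 0))) :=
      ((((hE.const_mul _).const_add _).const_add 1).const_mul s |>.const_mul _).add
        ((hE.const_mul L).const_mul _)
    have := ge_of_tendsto' ht (h η hη)
    simpa using this
  have hc : Filter.Tendsto (fun η : ℝ => (1 + η) * (s * (1 + (1 + η) * c)))
      (nhdsWithin 0 (Set.Ioi 0)) (nhds ((1 + 0) * (s * (1 + (1 + 0) * c)))) := by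
    refine Filter.Tendsto.mono_left (Continuous.tendsto (by fun_prop) 0) nhdsWithin_le_nhds
  have := ge_of_tendsto hc (by
    filter_upwards [self_mem_nhdsWithin] with η hη using h1 η hη)
  simpa using this

/-! ### Mean-square convergence of the stochastic recursion. -/

section Convergence

variable {Ω : Type*} [m₀ : MeasurableSpace Ω] {P : Measure Ω} [IsProbabilityMeasure P]
  {ι : Type*} [Fintype ι]

/-- The iterates of a stochastic affine recursion with bounded coefficients stay square-integrable.
-/
theorem memLp_affine_recursion {G : ℕ → Ω → Matrix ι ι ℝ} {g : ℕ → Ω → ι → ℝ}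
    {z : ℕ → Ω → EuclideanSpace ℝ ι} (hG : ∀ k a b, Measurable fun ω => G k ω a b)
    (hGb : ∀ k a b, ∃ C, ∀ ω, |G k ω a b| ≤ C) (hg : ∀ k a, Measurable fun ω => g k ω a)
    (hgb : ∀ k a, ∃ C, ∀ ω, |g k ω a| ≤ C) (hz : ∀ k, Measurable (z k)) (hz0 : MemLp (z 0) 2 P)
    {α : ℕ → ℝ} (hstep : ∀ k ω, (z (k + 1) ω).ofLp =
      (z k ω).ofLp - α k • (G k ω *ᵥ (z k ω).ofLp - g k ω)) (k : ℕ) : MemLp (z k) 2 P := by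
  refine memLp_of_coord (hz k) ?_
  induction k with
  | zero => exact memLp_coord hz0
  | succ k ih =>
    intro a
    simp only [hstep, sub_eq_add_neg (G k _ *ᵥ _)]
    exact (ih a).sub ((memLp_affine_step (f := fun ω => -g k ω) (hG k) (hGb k)
      (fun a => (hg k a).neg) (fun a => by simpa using hgb k a) ih a).const_mul _)

/-- The mean-square error of a stochastic-approximation recursion driven by independent bounded
samples whose mean update contracts a quadratic form. -/
theorem stochastic_approximation_bound {m past : ℕ → MeasurableSpace Ω}
    (hm : ∀ k, m k ≤ m₀) (hind : ∀ k, Indep (m k) (past k) P)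
    {G : ℕ → Ω → Matrix ι ι ℝ} {g : ℕ → Ω → ι → ℝ} {z : ℕ → Ω → EuclideanSpace ℝ ι}
    (hG : ∀ k a b, Measurable[m k] fun ω => G k ω a b)
    (hGb : ∀ k a b, ∃ C, ∀ ω, |G k ω a b| ≤ C)
    (hg : ∀ k a, Measurable[m k] fun ω => g k ω a) (hgb : ∀ k a, ∃ C, ∀ ω, |g k ω a| ≤ C)
    (hz : ∀ k, Measurable (z k)) (hzp : ∀ k, Measurable[past k] (z k)) (hz0 : MemLp (z 0) 2 P)
    {α : ℕ → ℝ}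
    (hstep : ∀ k ω, (z (k + 1) ω).ofLp =
      (z k ω).ofLp - α k • (G k ω *ᵥ (z k ω).ofLp - g k ω))
    {Gm H : Matrix ι ι ℝ} {Q : ℕ → Matrix ι ι ℝ} {gm : ι → ℝ} {zstar : EuclideanSpace ℝ ι}
    (hGm : ∀ k a b, ∫ ω, G k ω a b ∂P = Gm a b) (hgm : ∀ k a, ∫ ω, g k ω a ∂P = gm a)
    (hzstar : Gm *ᵥ zstar.ofLp = gm)
    {δ ζ l h L σ q : ℝ} (hδ : 0 < δ) (hζ : 0 < ζ) (hl : 0 < l) (hh : 0 ≤ h) (hL0 : 0 ≤ L)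
    (hQ : ∀ k a b, ∫ ω, ((G k ω)ᵀ * G k ω) a b ∂P = Q k a b)
    (hL : ∀ k x, x ⬝ᵥ (Q k *ᵥ x) ≤ L * (x ⬝ᵥ x))
    (hH : Hᵀ = H) (hHl : ∀ x, l * (x ⬝ᵥ x) ≤ x ⬝ᵥ (H *ᵥ x))
    (hHh : ∀ x, x ⬝ᵥ (H *ᵥ x) ≤ h * (x ⬝ᵥ x))
    (hdrift : ∀ x, δ * (x ⬝ᵥ (H *ᵥ x)) ≤ (H *ᵥ x) ⬝ᵥ (Gm *ᵥ x))
    (hα : ∀ k, α k = 2 * δ / (δ ^ 2 * (k + 2) + ζ))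
    (hη : 2 * (h / l * L) + δ ^ 2 / 4 ≤ ζ / 2)
    (hq : ∀ k, ∫ ω, (G k ω *ᵥ zstar.ofLp - g k ω) ⬝ᵥ (G k ω *ᵥ zstar.ofLp - g k ω) ∂P = q)
    (hσ : ∀ k, ∫ ω, (G k ω *ᵥ (z k ω).ofLp - g k ω) ⬝ᵥ (G k ω *ᵥ (z k ω).ofLp - g k ω) ∂P ≤
      σ ^ 2 * (1 + ∫ ω, ‖z k ω‖ ^ 2 ∂P)) (k : ℕ) :
    MemLp (z k) 2 P ∧ ∫ ω, ‖z k ω - zstar‖ ^ 2 ∂P ≤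
      h / l * (ζ ^ 2 * (∫ ω, ‖z 0 ω - zstar‖ ^ 2 ∂P) / (δ ^ 2 * k + ζ) ^ 2 +
        8 * (σ ^ 2 * (1 + ‖zstar‖ ^ 2)) / (δ ^ 2 * k + ζ)) := by
  set D : ℕ → Ω → ι → ℝ := fun k ω => (z k ω).ofLp - zstar.ofLp with hD
  set f : ℕ → Ω → ι → ℝ := fun k ω => G k ω *ᵥ zstar.ofLp - g k ω with hf
  have hN : ∀ k ω, G k ω *ᵥ (z k ω).ofLp - g k ω = G k ω *ᵥ D k ω + f k ω := fun k ω => by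
    simp only [hD, hf, mulVec_sub]; abel
  have hDstep : ∀ k ω, D (k + 1) ω = D k ω - α k • (G k ω *ᵥ D k ω + f k ω) := fun k ω => by
    rw [← hN]; simp only [hD, hstep]; abel
  have hGm0 : ∀ k a b, Measurable fun ω => G k ω a b := fun k a b => (hG k a b).mono (hm k) le_rfl
  have hfm : ∀ k a, Measurable[m k] fun ω => f k ω a := fun k a =>
    (Finset.measurable_fun_sum _ fun b _ => (hG k a b).mul_const _).sub (hg k a)
  have hfm0 : ∀ k a, Measurable fun ω => f k ω a := fun k a => (hfm k a).mono (hm k) le_rfl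
  have hfb : ∀ k a, ∃ C, ∀ ω, |f k ω a| ≤ C := fun k a => by
    choose C hC using hGb k a
    obtain ⟨C', hC'⟩ := hgb k a
    refine ⟨∑ b, C b * |zstar b| + C', fun ω => (abs_sub _ _).trans (add_le_add ?_ (hC' ω))⟩
    refine (Finset.abs_sum_le_sum_abs _ _).trans (Finset.sum_le_sum fun b _ => ?_)
    rw [abs_mul]
    exact mul_le_mul_of_nonneg_right (hC b ω) (abs_nonneg _)
  have hf0 : ∀ k a, ∫ ω, f k ω a ∂P = 0 := fun k a => by
    have hi : ∀ b, Integrable (fun ω => G k ω a b * zstar b) P := fun b =>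
      (integrable_of_measurable_of_bounded (hGm0 k a b) (hGb k a b)).mul_const _
    have hgi := integrable_of_measurable_of_bounded (P := P)
      ((hg k a).mono (hm k) le_rfl) (hgb k a)
    have e : ∀ ω, f k ω a = ∑ b, G k ω a b * zstar b - g k ω a := fun ω => rfl
    simp only [e]
    rw [integral_sub (integrable_finsetSum _ fun b _ => hi b) hgi,
      integral_finsetSum _ fun b _ => hi b, hgm, ← hzstar]
    simp only [integral_mul_const, hGm]
    exact sub_self _
  have hzL : ∀ k, MemLp (z k) 2 P := memLp_affine_recursion hGm0 hGb
    (fun k a => (hg k a).mono (hm k) le_rfl) hgb hz hz0 hstep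
  have hDL : ∀ k a, MemLp (fun ω => D k ω a) 2 P := fun k a =>
    (memLp_coord (hzL k) a).sub (memLp_const _)
  have hDm : ∀ k a, Measurable[past k] fun ω => D k ω a := fun k a =>
    (measurable_coord (hzp k) a).sub_const _
  have hnorm : ∀ k ω, ‖z k ω - zstar‖ ^ 2 = D k ω ⬝ᵥ D k ω := fun k ω =>
    norm_sq_eq_dotProduct _
  have hDD : ∀ k, Integrable (fun ω => D k ω ⬝ᵥ D k ω) P := fun k =>
    integrable_finsetSum _ fun a _ => (hDL k a).integrable_mul (hDL k a)
  set E : ℕ → ℝ := fun k => ∫ ω, D k ω ⬝ᵥ D k ω ∂P with hE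
  have hE' : ∀ k, ∫ ω, ‖z k ω - zstar‖ ^ 2 ∂P = E k := fun k => by simp only [hnorm, hE]
  have hEn : ∀ k, 0 ≤ E k := fun k => integral_nonneg fun ω => dotProduct_self_nonneg_real _
  have hq0 : 0 ≤ q := by
    rw [← hq 0]; exact integral_nonneg fun ω => dotProduct_self_nonneg_real _
  set a : ℕ → ℝ := fun k => ∫ ω, D k ω ⬝ᵥ (H *ᵥ D k ω) ∂P with ha
  have ha1 : ∀ k, l * E k ≤ a k := fun k => by
    simp only [hE, ha]
    rw [← integral_const_mul]
    exact integral_mono ((hDD k).const_mul _) (integrable_form (hDL k) H) fun ω => hHl _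
  have ha2 : ∀ k, a k ≤ h * E k := fun k => by
    simp only [hE, ha]
    rw [← integral_const_mul]
    exact integral_mono (integrable_form (hDL k) H) ((hDD k).const_mul _) fun ω => hHh _
  have hrec := recursion_bound (a := a) (B := 2 * h * q) hδ hζ (by positivity) hη
    (fun k => (mul_nonneg hl.le (hEn k)).trans (ha1 k)) (fun k => by
      have hαk : 0 ≤ α k := by rw [hα]; positivity
      have := expected_form_step_le (hm k) (hind k) (hG k) (hGb k) (hfm k) (hfb k) (hf0 k) (hDm k)
        (hDL k) hl hh hL0 hαk (hGm k) (hQ k) (hL k) hH hHl hHh hdrift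
      have hq' : ∫ ω, f k ω ⬝ᵥ f k ω ∂P = q := hq k
      simp only [← hDstep] at this
      rw [hq'] at this
      rw [← hα]
      linarith)
  -- The rate with the noise level `q` at the solution still unspecified; the factor `h / l` is the
  -- price of passing from the Euclidean norm to the form `H` and back.
  have hmain : ∀ k : ℕ, E k ≤ h / l * (ζ ^ 2 * E 0 / (δ ^ 2 * k + ζ) ^ 2 +
      8 * q / (δ ^ 2 * k + ζ)) := fun k => by
    have h1 := (ha1 k).trans (hrec k)
    have h2 : ζ ^ 2 * a 0 / (δ ^ 2 * k + ζ) ^ 2 ≤ ζ ^ 2 * (h * E 0) / (δ ^ 2 * k + ζ) ^ 2 := by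
      gcongr; exact ha2 0
    have h3 : E k ≤ (ζ ^ 2 * (h * E 0) / (δ ^ 2 * k + ζ) ^ 2 +
        4 * (2 * h * q) / (δ ^ 2 * k + ζ)) / l := by
      rw [le_div_iff₀ hl]; linarith
    refine h3.trans (le_of_eq ?_)
    ring
  have hlim : Filter.Tendsto E Filter.atTop (nhds 0) := by
    have ht : Filter.Tendsto (fun k : ℕ => δ ^ 2 * (k : ℝ) + ζ) Filter.atTop Filter.atTop :=
      Filter.tendsto_atTop_add_const_right _ _
        (tendsto_natCast_atTop_atTop.const_mul_atTop (by positivity))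
    have ht2 := (Filter.tendsto_pow_atTop (two_ne_zero)).comp ht
    have := ((ht2.const_div_atTop (ζ ^ 2 * E 0)).add (ht.const_div_atTop (8 * q))).const_mul (h / l)
    simp only [add_zero, mul_zero] at this
    exact squeeze_zero hEn hmain this
  -- Here `q` is the second moment of `f k = (G D + f) - G D`. The first part is controlled by `hσ`,
  -- the second by `L * E k`. Since `q` does not depend on `k` while `E k → 0`, the limit in `k` and
  -- then in the Young parameter `η` removes every error term.
  have hqσ : q ≤ σ ^ 2 * (1 + ‖zstar‖ ^ 2) := by
    refine le_of_forall_young (L := L) hlim fun η hη k => ?_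
    obtain ⟨i3, e3⟩ := integral_sq_mulVec_of_indep (hm k) (hind k) (hG k) (hGb k) (hDm k) (hDL k)
      (hQ k)
    have hGD : ∀ ω, D k ω ⬝ᵥ (((G k ω)ᵀ * G k ω) *ᵥ D k ω) =
        (G k ω *ᵥ D k ω) ⬝ᵥ (G k ω *ᵥ D k ω) := fun ω => by
      rw [← mulVec_mulVec, ← mulVec_dotProduct_eq]
    have h3 : ∫ ω, (G k ω *ᵥ D k ω) ⬝ᵥ (G k ω *ᵥ D k ω) ∂P ≤ L * E k := by
      simp only [← hGD]
      rw [e3, hE, ← integral_const_mul]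
      exact integral_mono (integrable_form (hDL k) _) ((hDD k).const_mul _) fun ω => hL k _
    simp only [hGD] at i3
    have iN : Integrable (fun ω => (G k ω *ᵥ D k ω + f k ω) ⬝ᵥ (G k ω *ᵥ D k ω + f k ω)) P :=
      integrable_finsetSum _ fun a _ =>
        (memLp_affine_step (hGm0 k) (hGb k) (hfm0 k) (hfb k) (hDL k) a).integrable_mul
          (memLp_affine_step (hGm0 k) (hGb k) (hfm0 k) (hfb k) (hDL k) a)
    have h1 : q ≤ (1 + η) * ∫ ω, (G k ω *ᵥ D k ω + f k ω) ⬝ᵥ (G k ω *ᵥ D k ω + f k ω) ∂P +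
        (1 + 1 / η) * ∫ ω, (G k ω *ᵥ D k ω) ⬝ᵥ (G k ω *ᵥ D k ω) ∂P := by
      rw [← hq k, ← integral_const_mul, ← integral_const_mul,
        ← integral_add (iN.const_mul _) (i3.const_mul _)]
      refine integral_mono_of_nonneg
        (Filter.Eventually.of_forall fun ω => dotProduct_self_nonneg_real _)
        ((iN.const_mul _).add (i3.const_mul _)) (Filter.Eventually.of_forall fun ω => ?_)
      have := dotProduct_sub_self_le hη (G k ω *ᵥ D k ω + f k ω) (G k ω *ᵥ D k ω)
      rwa [add_sub_cancel_left] at this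
    have hs := hσ k
    simp only [hN] at hs
    have h2 : ∫ ω, ‖z k ω‖ ^ 2 ∂P ≤ (1 + η) * ‖zstar‖ ^ 2 + (1 + 1 / η) * E k := by
      have e : (1 + η) * ‖zstar‖ ^ 2 + (1 + 1 / η) * E k =
          ∫ ω, ((1 + η) * ‖zstar‖ ^ 2 + (1 + 1 / η) * (D k ω ⬝ᵥ D k ω)) ∂P := by
        rw [integral_add (integrable_const _) ((hDD k).const_mul _), integral_const, integral_const_mul]
        simp [hE]
      rw [e]
      refine integral_mono_of_nonneg (Filter.Eventually.of_forall fun ω => by positivity)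
        ((integrable_const _).add ((hDD k).const_mul _)) (Filter.Eventually.of_forall fun ω => ?_)
      have := dotProduct_sub_self_le hη zstar.ofLp (-D k ω)
      have e2 : zstar.ofLp - -D k ω = (z k ω).ofLp := by simp [hD]
      rw [e2, neg_dotProduct_neg] at this
      simp only [norm_sq_eq_dotProduct]
      exact this
    have hs2 : σ ^ 2 * (1 + ∫ ω, ‖z k ω‖ ^ 2 ∂P) ≤
        σ ^ 2 * (1 + ((1 + η) * ‖zstar‖ ^ 2 + (1 + 1 / η) * E k)) := by gcongr
    calc q ≤ _ := h1
      _ ≤ _ := by gcongr; exact hs.trans hs2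
  refine ⟨hzL k, ?_⟩
  rw [hE', hE']
  refine (hmain k).trans ?_
  gcongr

end Convergence

/-! ### The sigma-algebras of the sample and of the past. -/

namespace Problem

variable {S Act : Type*} [Fintype S] [Fintype Act] {d : ℕ}

theorem sampleSigma_le {Ω : Type*} [mΩ : MeasurableSpace Ω] {p : Problem S Act d} {P : Measure Ω}
    {X : ℕ → Ω → S × Act} {S' : Ω → S} (h : p.IsStationarySample P X S') :
    sampleSigma X S' ≤ mΩ :=
  sup_le (iSup_le fun j => (h.measurable_pair j).comap_le) h.measurable_next.comap_le

theorem BoundedLocal.measurable_sampleSigma {Ω : Type*} {F : (ℕ → S × Act) → S → ℝ}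
    (hF : BoundedLocal F) (X : ℕ → Ω → S × Act) (S' : Ω → S) :
    Measurable[sampleSigma X S'] fun ω => F (fun j => X j ω) (S' ω) := by
  refine hF.measurable (m := sampleSigma X S') (fun j => ?_) ?_
  · rw [measurable_iff_comap_le]
    exact (le_iSup (fun j => MeasurableSpace.comap (X j) ⊤) j).trans le_sup_left
  · rw [measurable_iff_comap_le]
    exact le_sup_right

end Problem

theorem measurable_pastSigma {Ω : Type*} {d : ℕ} (z : ℕ → Ω → EuclideanSpace ℝ (Fin d ⊕ Fin d))
    (G : ℕ → Ω → Matrix (Fin d ⊕ Fin d) (Fin d ⊕ Fin d) ℝ) (g : ℕ → Ω → Fin d ⊕ Fin d → ℝ)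
    (k : ℕ) : Measurable[pastSigma z G g k] (z k) := by
  rw [measurable_iff_comap_le]
  exact (le_iSup₂ (f := fun i (_ : i ≤ k) => MeasurableSpace.comap (z i) inferInstance) k
    le_rfl).trans le_sup_left

theorem pastSigma_le {Ω : Type*} [mΩ : MeasurableSpace Ω] {d : ℕ}
    {z : ℕ → Ω → EuclideanSpace ℝ (Fin d ⊕ Fin d)}
    {G : ℕ → Ω → Matrix (Fin d ⊕ Fin d) (Fin d ⊕ Fin d) ℝ} {g : ℕ → Ω → Fin d ⊕ Fin d → ℝ}
    (hz : ∀ k, Measurable (z k)) (hG : ∀ k a b, Measurable fun ω => G k ω a b)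
    (hg : ∀ k, Measurable (g k)) (k : ℕ) : pastSigma z G g k ≤ mΩ :=
  sup_le (iSup₂_le fun i _ => (hz i).comap_le) (iSup₂_le fun i _ =>
    sup_le (iSup₂_le fun a b => (hG i a b).comap_le) (hg i).comap_le)

end OffPolicy

/-! ### Assembly. -/

open OffPolicy Matrix MeasureTheory ProbabilityTheory in
theorem proposition4
    {S Act : Type*} [Fintype S] [Fintype Act] [DecidableEq S] [DecidableEq Act]
    {d : ℕ} (hd : 0 < d) (p : OffPolicy.Problem S Act d)
    (rule : OffPolicy.TraceRule) (form : OffPolicy.DualForm)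
    {Ω : Type*} [MeasurableSpace Ω] (P : MeasureTheory.Measure Ω)
    [MeasureTheory.IsProbabilityMeasure P]
    -- the sample of iteration `k`
    (X : ℕ → ℕ → Ω → S × Act) (S' : ℕ → Ω → S)
    -- the initial parameters
    (θ₀ ω₀ : Ω → Fin d → ℝ)
    -- the matrices and the vector of the saddle-point problem
    (A M : Matrix (Fin d) (Fin d) ℝ)
    (hA : A = p.matA rule) (hM : M = p.matM form)
    -- the constants
    (LG σ β δ ζ : ℝ)
    (hδ : δ = OffPolicy.delta A M)
    (hβ : β = OffPolicy.beta A M) (hζ : ζ = OffPolicy.zeta A M LG)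
    -- the joint iterates, the random `Ĝ_k` and `ĝ_k`, the past, and the solution
    (z : ℕ → Ω → EuclideanSpace ℝ (Fin d ⊕ Fin d))
    (hz : ∀ k ω, z k ω = p.jointIterate rule form (OffPolicy.stepSize A M LG) β
      (fun i j => X i j ω) (fun i => S' i ω) (θ₀ ω) (ω₀ ω) k)
    (G : ℕ → Ω → Matrix (Fin d ⊕ Fin d) (Fin d ⊕ Fin d) ℝ)
    (hG : ∀ k ω, G k ω = p.estG rule form β (fun j => X k j ω) (S' k ω))
    (g : ℕ → Ω → Fin d ⊕ Fin d → ℝ)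
    (hg : ∀ k ω, g k ω = p.estg rule β (fun j => X k j ω))
    (past : ℕ → MeasurableSpace Ω) (hpast : past = OffPolicy.pastSigma z G g)
    (zstar : EuclideanSpace ℝ (Fin d ⊕ Fin d)) (hzstar : zstar = p.solution rule β)
    -- square-integrable initialisation
    (hθ₀ : Measurable θ₀) (hω₀ : Measurable ω₀)
    (hz₀ : MeasureTheory.MemLp (z 0) 2 P)
    -- the samples are stationary, and each is drawn independently of the past
    (hX : ∀ k, p.IsStationarySample P (X k) (S' k))
    (hindep : ∀ k, ProbabilityTheory.Indep
      (OffPolicy.Problem.sampleSigma (X k) (S' k)) (past k) P)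
    -- nonsingularity
    (hAns : IsUnit A.det) (hMns : IsUnit M.det)
    -- the conditional second moment of the update
    (hσ : ∀ k, MeasureTheory.condExp (past k) P
        (fun ω => ‖Matrix.toEuclideanCLM (𝕜 := ℝ) (G k ω) (z k ω) - WithLp.toLp 2 (g k ω)‖ ^ 2)
      ≤ᵐ[P] fun ω => σ ^ 2 * (1 + ‖z k ω‖ ^ 2))
    -- `L_G` is the spectral norm of the conditional expectation of `Ĝ_kᵀ Ĝ_k`
    (hLG : ∀ k, ∀ᵐ ω ∂P, LG = OffPolicy.specNorm (Matrix.of fun a b =>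
      MeasureTheory.condExp (past k) P (fun ω' => ((G k ω').transpose * G k ω') a b) ω)) :
    (∀ k : ℕ,
      MeasureTheory.MemLp (z k) 2 P ∧
      ∫ ω, ‖z k ω - zstar‖ ^ 2 ∂P ≤
        9 ^ 2 * (8 * OffPolicy.condNumber M) *
          ((8 * δ + 9 * ζ) ^ 2 * (∫ ω, ‖z 0 ω - zstar‖ ^ 2 ∂P)
              / (8 ^ 2 * δ ^ 2 * (k : ℝ) + 9 ^ 2 * ζ) ^ 2
            + 8 * σ ^ 2 * (1 + ‖zstar‖ ^ 2) / (8 ^ 2 * δ ^ 2 * (k : ℝ) + 9 ^ 2 * ζ))) ∧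
    (fun k : ℕ => ∫ ω, ‖z k ω - zstar‖ ^ 2 ∂P) =O[Filter.atTop] fun k : ℕ => 1 / (k : ℝ) := by
  subst hA hM hδ hζ hzstar
  set A := p.matA rule with hAdef
  set M := p.matM form with hMdef
  have : Nonempty (Fin d) := ⟨⟨0, hd⟩⟩
  have hMpd : M.PosDef :=
    (p.matM_posSemidef form).posDef_iff_isUnit.2 ((Matrix.isUnit_iff_isUnit_det M).2 hMns)
  have hδ0 := delta_pos hd hAns hMpd
  have hρ0 := hδ0.trans_le (delta_le_rho hd hMpd)
  have hβ0 : 0 < β := hβ ▸ beta_pos hd hAns hMpd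
  have hc1 := one_le_condNumber hMns
  have hc0 : 0 < condNumber M := by linarith
  have hGeq : ∀ k a b, (fun ω => G k ω a b) =
      fun ω => p.estG rule form β (fun j => X k j ω) (S' k ω) a b := fun k a b => by
    funext ω; rw [hG]
  have hgeq : ∀ k a, (fun ω => g k ω a) = fun ω => p.estg rule β (fun j => X k j ω) a :=
    fun k a => by funext ω; rw [hg]
  have hGm : ∀ k a b, Measurable[Problem.sampleSigma (X k) (S' k)] fun ω => G k ω a b :=
    fun k a b => by
      rw [hGeq]; exact (p.boundedLocal_estG rule form β a b).measurable_sampleSigma (X k) (S' k)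
  have hgm : ∀ k a, Measurable[Problem.sampleSigma (X k) (S' k)] fun ω => g k ω a :=
    fun k a => by
      rw [hgeq]; exact (p.boundedLocal_estg (S := S) rule β a).measurable_sampleSigma (X k) (S' k)
  have hm : ∀ k, Problem.sampleSigma (X k) (S' k) ≤ ‹MeasurableSpace Ω› := fun k =>
    Problem.sampleSigma_le (hX k)
  have hGm0 : ∀ k a b, Measurable fun ω => G k ω a b := fun k a b =>
    (hGm k a b).mono (hm k) le_rfl
  have hgm0 : ∀ k a, Measurable fun ω => g k ω a := fun k a => (hgm k a).mono (hm k) le_rfl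
  have hGb : ∀ k a b, ∃ C, ∀ ω, |G k ω a b| ≤ C := fun k a b => by
    obtain ⟨C, hC⟩ := (p.boundedLocal_estG rule form β a b).bounded
    exact ⟨C, fun ω => by rw [hG]; exact hC _ _⟩
  have hgb : ∀ k a, ∃ C, ∀ ω, |g k ω a| ≤ C := fun k a => by
    obtain ⟨C, hC⟩ := (p.boundedLocal_estg (S := S) rule β a).bounded
    exact ⟨C, fun ω => by rw [hg]; exact hC _ (S' k ω)⟩
  have hstep : ∀ k ω, (z (k + 1) ω).ofLp =
      (z k ω).ofLp - stepSize A M LG k • (G k ω *ᵥ (z k ω).ofLp - g k ω) := fun k ω => by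
    rw [hz, hz, hG, hg]
    exact p.jointIterate_succ rule form (stepSize A M LG) hβ0 _ _ _ _ k
  have hzm : ∀ k, Measurable (z k) := by
    intro k
    refine measurable_of_coord ?_
    induction k with
    | zero =>
      intro a
      simp only [hz]
      rcases a with i | i
      · exact (measurable_pi_apply i).comp hθ₀
      · exact ((measurable_pi_apply i).comp hω₀).const_mul (1 / √β)
    | succ k ih =>
      intro a
      simp only [hstep]
      exact (ih a).sub (((Finset.measurable_fun_sum Finset.univ fun b _ =>
        (hGm0 k a b).mul (ih b)).sub (hgm0 k a)).const_mul _)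
  have hpm : ∀ k, past k ≤ ‹MeasurableSpace Ω› := fun k => by
    rw [hpast]; exact pastSigma_le hzm hGm0 (fun k => measurable_pi_iff.2 (hgm0 k)) k
  have hzp : ∀ k, Measurable[past k] (z k) := fun k => by
    rw [hpast]; exact measurable_pastSigma z G g k
  have hzL := memLp_affine_recursion hGm0 hGb hgm0 hgb hzm hz₀ hstep
  have hGGl : ∀ a b, Problem.BoundedLocal fun x s =>
      ((p.estG rule form β x s)ᵀ * p.estG rule form β x s) a b := fun a b =>
    .sum Finset.univ fun c => (p.boundedLocal_estG rule form β c a).mul (p.boundedLocal_estG rule form β c b)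
  set Q : ℕ → Matrix (Fin d ⊕ Fin d) (Fin d ⊕ Fin d) ℝ := fun k =>
    Matrix.of fun a b => ∫ ω, ((G k ω)ᵀ * G k ω) a b ∂P
  -- By independence the conditional expectations are almost surely the constants `Q k a b`.
  -- Finitely many entries are involved, so a single `ω` serves all of them.
  have hLQ : ∀ k, LG = specNorm (Q k) := by
    intro k
    have hce : ∀ a b, condExp (past k) P (fun ω' => ((G k ω')ᵀ * G k ω') a b) =ᵐ[P]
        fun _ => Q k a b := fun a b => by
      refine condExp_indep_eq (hm k) (hpm k) ?_ (hindep k)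
      refine Measurable.stronglyMeasurable ?_
      have := (hGGl a b).measurable_sampleSigma (X k) (S' k)
      simpa only [← hG] using this
    have hall : ∀ᵐ ω ∂P, ∀ a b, condExp (past k) P (fun ω' => ((G k ω')ᵀ * G k ω') a b) ω =
        Q k a b := ae_all_iff.2 fun a => ae_all_iff.2 fun b => hce a b
    obtain ⟨ω, h1, h2⟩ := ((hLG k).and hall).exists
    rw [h1]
    congr 1
    ext a b
    exact h2 a b
  have hLG0 : 0 ≤ LG := hLQ 0 ▸ specNorm_nonneg _
  have hfl : ∀ a, Problem.BoundedLocal fun x s =>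
      (p.estG rule form β x s *ᵥ (p.solution rule β).ofLp - p.estg rule β x) a := fun a =>
    (Problem.BoundedLocal.sum Finset.univ fun b => (p.boundedLocal_estG rule form β a b).mul (.const
      ((p.solution rule β).ofLp b))).sub
      (p.boundedLocal_estg rule β a)
  -- As a bounded local function of the sample, `‖Ĝ z* - ĝ‖²` has the same expectation for every
  -- `k`; this makes `q` a constant.
  have hql := Problem.BoundedLocal.sum Finset.univ fun a => (hfl a).mul (hfl a)
  have hzeta := zeta_pos hd hAns hMpd hLG0
  have key := stochastic_approximation_bound (P := P) hm hindep hGm hGb hgm hgb hzm hzp hz₀ hstep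
    (Gm := Problem.jointMatrix β A M) (H := symmetrizer A M) (Q := Q)
    (gm := Sum.elim 0 (√β • p.vecb rule)) (zstar := p.solution rule β)
    (δ := 8 / 9 * delta A M) (ζ := zeta A M LG) (l := rho A M)
    (h := 8 * rho A M * condNumber M) (L := LG) (σ := σ)
    (q := ∫ ω, (G 0 ω *ᵥ (p.solution rule β).ofLp - g 0 ω) ⬝ᵥ
      (G 0 ω *ᵥ (p.solution rule β).ofLp - g 0 ω) ∂P)
    (fun k a b => by
      rw [hGeq]; exact Problem.integral_estG (hX k) rule form β a b)
    (fun k a => by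
      rw [hgeq]; exact Problem.integral_estg (hX k) rule β a)
    (p.jointMatrix_mulVec_solution rule form β hAns)
    (by positivity) hzeta hρ0 (by positivity) hLG0
    (fun k a b => rfl)
    (fun k x => by rw [hLQ k]; exact dotProduct_mulVec_le_specNorm _ x)
    (symmetrizer_transpose hMpd)
    (fun x => (le_symmetrizer_form hd hAns hMpd x).1)
    (fun x => (le_symmetrizer_form hd hAns hMpd x).2)
    -- The contraction holds at rate `δ` and is weakened to `8δ/9`, the rate built into the step
    -- sizes.
    (fun x => by
      have h1 := symmetrizer_form_contraction hd hAns hMpd x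
      have h2 : 0 ≤ delta A M * (x ⬝ᵥ (symmetrizer A M *ᵥ x)) :=
        mul_nonneg hδ0.le ((mul_nonneg hρ0.le (dotProduct_self_nonneg_real x)).trans
          (le_symmetrizer_form hd hAns hMpd x).1)
      rw [hβ]
      linarith)
    (stepSize_eq LG)
    (by
      have h1 := zeta_slack hd hAns hMpd LG
      have h2 : 8 * rho A M * condNumber M / rho A M = 8 * condNumber M := by field_simp
      rw [h2]
      linarith)
    (fun k => by
      simp only [hG, hg]
      exact hql.integral_eq (hX k) (hX 0))
    (fun k => by
      have hz2 := (memLp_two_iff_integrable_sq_norm (hzm k).aestronglyMeasurable).1 (hzL k)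
      -- Only the integrated form of the conditional moment bound is needed.
      have h1 := integral_mono_ae integrable_condExp
        (((integrable_const (1 : ℝ)).add hz2).const_mul (σ ^ 2)) (hσ k)
      rw [integral_condExp (hpm k), integral_const_mul, integral_add' (integrable_const 1) hz2] at h1
      simpa [norm_sq_eq_dotProduct] using h1)
  have hbound : ∀ k : ℕ, ∫ ω, ‖z k ω - p.solution rule β‖ ^ 2 ∂P ≤
      9 ^ 2 * (8 * condNumber M) *
        ((8 * delta A M + 9 * zeta A M LG) ^ 2 * (∫ ω, ‖z 0 ω - p.solution rule β‖ ^ 2 ∂P)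
            / (8 ^ 2 * delta A M ^ 2 * (k : ℝ) + 9 ^ 2 * zeta A M LG) ^ 2
          + 8 * σ ^ 2 * (1 + ‖p.solution rule β‖ ^ 2) /
            (8 ^ 2 * delta A M ^ 2 * (k : ℝ) + 9 ^ 2 * zeta A M LG)) := by
    intro k
    refine (key k).2.trans ?_
    have hE0 : 0 ≤ ∫ ω, ‖z 0 ω - p.solution rule β‖ ^ 2 ∂P :=
      integral_nonneg fun ω => by positivity
    generalize ∫ ω, ‖z 0 ω - p.solution rule β‖ ^ 2 ∂P = E0 at hE0 ⊢
    generalize 1 + ‖p.solution rule β‖ ^ 2 = n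
    generalize delta A M = δ at *
    generalize zeta A M LG = ζ at *
    have h2 : 8 * rho A M * condNumber M / rho A M = 8 * condNumber M := by field_simp
    have hT : 8 ^ 2 * δ ^ 2 * (k : ℝ) + 9 ^ 2 * ζ = 81 * ((8 / 9 * δ) ^ 2 * k + ζ) := by ring
    rw [h2, hT]
    set t := (8 / 9 * δ) ^ 2 * (k : ℝ) + ζ with ht
    have ht0 : 0 < t := by positivity
    -- Once the denominators are cleared of `81`, the bound obtained has `(9ζ)²` in place of `(8δ +
    -- 9ζ)²`.
    have h3 : 81 * ζ ^ 2 ≤ (8 * δ + 9 * ζ) ^ 2 := by nlinarith [mul_pos hδ0 hzeta]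
    have e : 9 ^ 2 * (8 * condNumber M) * ((8 * δ + 9 * ζ) ^ 2 * E0 / (81 * t) ^ 2 +
        8 * σ ^ 2 * n / (81 * t)) =
        8 * condNumber M * ((8 * δ + 9 * ζ) ^ 2 / 81 * E0 / t ^ 2 + 8 * (σ ^ 2 * n) / t) := by
      field_simp
      ring
    rw [e]
    gcongr
    linarith
  refine ⟨fun k => ⟨(key k).1, hbound k⟩, ?_⟩
  have hE0 : 0 ≤ ∫ ω, ‖z 0 ω - p.solution rule β‖ ^ 2 ∂P :=
    integral_nonneg fun ω => by positivity
  refine Asymptotics.IsBigO.of_bound (9 ^ 2 * (8 * condNumber M) *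
    ((8 * delta A M + 9 * zeta A M LG) ^ 2 * (∫ ω, ‖z 0 ω - p.solution rule β‖ ^ 2 ∂P)
        / (9 ^ 2 * zeta A M LG * (8 ^ 2 * delta A M ^ 2))
      + 8 * σ ^ 2 * (1 + ‖p.solution rule β‖ ^ 2) / (8 ^ 2 * delta A M ^ 2))) ?_
  filter_upwards [Filter.eventually_ge_atTop 1] with k hk
  have hk0 : (0 : ℝ) < k := by exact_mod_cast hk
  rw [Real.norm_of_nonneg (integral_nonneg fun ω => by positivity),
    Real.norm_of_nonneg (by positivity)]
  refine (hbound k).trans ?_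
  rw [mul_assoc _ (_ + _) (1 / (k : ℝ)), add_mul, div_mul_div_comm, div_mul_div_comm, mul_one,
    mul_one]
  have h1 : 0 < 8 ^ 2 * delta A M ^ 2 * (k : ℝ) := by positivity
  gcongr
  -- The squared denominator is bounded below by the product of its two summands, which is linear in
  -- `k`.
  · nlinarith [mul_pos hzeta h1]
  · linarith

end
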